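/- Let $H$ be a real Hilbert space and let $A:D(A)\to H$ be a self-adjoint operator with dense domain that is coercive, i.e. $\langle Ax,x\rangle_H\ge\alpha\|x\|_H^2$ on $D(A)$ for some $\alpha>0$. Let $V=D(A^{1/2})$ with $\langle u,v\rangle_V=\langle A^{1/2}u,A^{1/2}v\rangle_H$, identify $H$ with its dual, so that $V\hookrightarrow H\hookrightarrow V'$, and write again $A:V\to V'$ for the extension $\langle Au,\varphi\rangle=\langle u,\varphi\rangle_V$. Let $\mathcal H=V\times H$. Let $B\in\mathcal L(V,V')$ satisfy $\langle Bv,v\rangle\ge 0$ for all $v\in V$. Let $f:V\to H$ be Lipschitz on bounded sets: for every $K>0$ there is $L(K)$ with $\|f(u)-f(v)\|_H\le L(K)\|u-v\|_V$ whenever $\|u\|_V,\|v\|_V\le K$. Let $\mathcal F:V\to\mathbb R$ be differentiable with $\mathcal F(0)=0$, $\mathcal F'(u)(v)=\langle f(u),v\rangle_H$ for all $u,v\in V$, and $\mathcal F\le 0$. Consider the problem $$u_{tt}(t)+Au(t)+Bu_t(t)=f(u(t)),\quad t>0,\qquad u(0)=u_0,\quad u_t(0)=u_1, \tag{2.1–2.2}$$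 let $D(L)=\{(u,v)\in V\times V:\ Au+Bv\in H\}$, and for a solution $u$ put $$E_S(t)=\tfrac12\big(\|u(t)\|_V^2+\|u_t(t)\|_H^2\big)-\mathcal F(u(t)).$$ For $0<T\le\infty$, a *weak solution* on $[0,T)$ is a function $u$ such that for every finite $S\in(0,T)$: $u\in L^2(0,S;V)\cap H^1(0,S;H)$, $f(u)\in L^2(0,S;H)$, $u(0)=u_0$, and $u_t+Bu\in H^1(0,S;V')$ with $(u_t+Bu)_t+Au=f(u)$ in $L^2(0,S;V')$ and $(u_t+Bu)(0)=u_1+Bu_0$. A *strong solution* on $[0,T)$ is a function $u$ such that for every finite $S\in(0,T)$: $(u,u_t)\in W^{1,\infty}(0,S;\mathcal H)$, and for a.e. $t\in(0,S)$ one has $(u(t),u_t(t))\in D(L)$ and $u_{tt}(t)+Au(t)+Bu_t(t)=f(u(t))$; moreover $(u,u_t)(0)=(u_0,u_1)$. **Theorem 2.3.** 1. Let $(u_0,u_1)\in D(L)$ and suppose that there is a constant $C>0$ such that $E_S(t)\le C\,E_S(0)$ for all $t\in(0,T)$, for every $T\in(0,\infty]$ and every strong solution on $[0,T)$ (in its representative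 with $(u,u_t)\in C([0,T);\mathcal H)$); that is, throughout the existence interval. Then the problem has a strong solution on $[0,\infty)$, and it is unique. 2. Let $(u_0,u_1)\in\mathcal H$ and suppose that there is a constant $C>0$ such that $E_S(t)\le C\,E_S(0)$ for all $t\in(0,T)$, for every $T\in(0,\infty]$ and every weak solution on $[0,T)$ with $(u,u_t)\in C([0,T);\mathcal H)$. Then the problem has a weak solution on $[0,\infty)$ with $(u,u_t)\in C([0,\infty);\mathcal H)$, and it is unique among all weak solutions on $[0,\infty)$. -/

import Mathlib

open MeasureTheory

/-- A self-adjoint, coercive (hence positive) operator `A : D(A) → H` with dense domain on a real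
Hilbert space. -/
structure CoerciveOperator (H : Type*) [NormedAddCommGroup H] [InnerProductSpace ℝ H]
    [CompleteSpace H] where
  /-- the unbounded operator -/
  op : H →ₗ.[ℝ] H
  dense_domain : Dense (op.domain : Set H)
  isSelfAdjoint : IsSelfAdjoint op
  coercive : ∃ α : ℝ, 0 < α ∧ ∀ x : op.domain, α * ‖(x : H)‖ ^ 2 ≤ inner ℝ (op x) (x : H)

/-- `R` is a nonnegative self-adjoint operator with `R ∘ R = A` (equality of unbounded operators,
domains included). -/
structure IsPosSqrt {H : Type*} [NormedAddCommGroup H] [InnerProductSpace ℝ H]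
    [CompleteSpace H] (A R : H →ₗ.[ℝ] H) : Prop where
  isSelfAdjoint : IsSelfAdjoint R
  nonneg : ∀ x : R.domain, 0 ≤ inner ℝ (R x) (x : H)
  comp_self : ∀ x y : H, (x, y) ∈ A.graph ↔ ∃ z, (x, z) ∈ R.graph ∧ (z, y) ∈ R.graph

namespace CoerciveOperator

/-! ### Existence of the square root -/

theorem catalan_partial_sum (N : ℕ) :
    ∑ n ∈ Finset.range N, (catalan n : ℝ) * (1 / 4) ^ n
      = 2 * (1 - (N.centralBinom : ℝ) * (1 / 4) ^ N) := by
  induction N with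
  | zero => simp
  | succ N ih =>
    rw [Finset.sum_range_succ, ih]
    have h1 : ((N : ℝ) + 1) * (N + 1).centralBinom = 2 * (2 * N + 1) * N.centralBinom := by
      exact_mod_cast Nat.succ_mul_centralBinom_succ N
    have h2 : ((N : ℝ) + 1) * catalan N = N.centralBinom := by
      exact_mod_cast succ_mul_catalan_eq_centralBinom N
    have h0 : ((N : ℝ) + 1) ≠ 0 := by positivity
    have h3 : ((N + 1).centralBinom : ℝ) = 2 * (2 * N + 1) * catalan N := by
      apply mul_left_cancel₀ h0
      rw [h1, ← h2]; ring
    rw [h3, ← h2, pow_succ]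
    ring

theorem catalan_summable : Summable fun n : ℕ => (catalan n : ℝ) * (1 / 4) ^ n := by
  refine summable_of_sum_range_le (c := 2) (fun n => by positivity) (fun N => ?_)
  rw [catalan_partial_sum]
  have : 0 ≤ (N.centralBinom : ℝ) * (1 / 4) ^ N := by positivity
  linarith

theorem catalan_tsum_le : ∑' n : ℕ, (catalan n : ℝ) * (1 / 4) ^ n ≤ 2 := by
  refine Real.tsum_le_of_sum_range_le (fun n => by positivity) (fun N => ?_)
  rw [catalan_partial_sum]
  have : 0 ≤ (N.centralBinom : ℝ) * (1 / 4) ^ N := by positivity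
  linarith

/-- A bounded symmetric operator `T` with `‖1 - T‖ ≤ 1` has a bounded nonnegative symmetric square
root. -/
theorem exists_bounded_sqrt {H : Type*} [NormedAddCommGroup H] [InnerProductSpace ℝ H]
    [CompleteSpace H] (T : H →L[ℝ] H) (hT : ∀ x y, inner ℝ (T x) y = inner ℝ x (T y))
    (hn : ‖1 - T‖ ≤ 1) :
    ∃ S : H →L[ℝ] H, (∀ x y, inner ℝ (S x) y = inner ℝ x (S y)) ∧
      (∀ x, 0 ≤ inner ℝ (S x) x) ∧ ∀ x, S (S x) = T x := by
  obtain ⟨K, hK⟩ : ∃ K : H →L[ℝ] H, K = 1 - T := ⟨_, rfl⟩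
  rw [← hK] at hn
  set c : ℕ → (H →L[ℝ] H) := fun n => ((catalan n : ℝ) * (1 / 4) ^ n) • K ^ n with hc
  have hpow : ∀ n : ℕ, ‖K ^ n‖ ≤ 1 := by
    intro n
    induction n with
    | zero => exact ContinuousLinearMap.norm_id_le
    | succ n ih =>
      rw [pow_succ]
      exact (norm_mul_le _ _).trans (mul_le_one₀ ih (norm_nonneg _) hn)
  have hcn : ∀ n, ‖c n‖ ≤ (catalan n : ℝ) * (1 / 4) ^ n := by
    intro n
    have h0 : 0 ≤ (catalan n : ℝ) * (1 / 4) ^ n := by positivity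
    rw [hc]
    simp only [norm_smul, Real.norm_of_nonneg h0]
    exact mul_le_of_le_one_right h0 (hpow n)
  have hsum : Summable fun n => ‖c n‖ :=
    Summable.of_nonneg_of_le (fun n => norm_nonneg _) hcn catalan_summable
  have hsum' : Summable c := hsum.of_norm
  set C : H →L[ℝ] H := ∑' n, c n with hC
  have hCn : ‖C‖ ≤ 2 :=
    (norm_tsum_le_tsum_norm hsum).trans
      ((hsum.tsum_le_tsum hcn catalan_summable).trans catalan_tsum_le)
  have hsym_pow : ∀ (n : ℕ) x y, inner ℝ ((K ^ n) x) y = inner ℝ x ((K ^ n) y) := by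
    intro n
    induction n with
    | zero => intro x y; simp
    | succ n ih =>
      intro x y
      have hk : ∀ x y, inner ℝ (K x) y = inner ℝ x (K y) := by
        intro x y
        simp [hK, inner_sub_left, inner_sub_right, hT]
      rw [pow_succ', mul_apply_eq_comp, hk, ih, ← mul_apply_eq_comp,
        ← pow_succ, pow_succ']
  have hcomm : K * C = C * K := by
    rw [hC, ← hsum'.tsum_mul_left, ← hsum'.tsum_mul_right]
    refine tsum_congr fun n => ?_
    simp only [hc, mul_smul_comm, smul_mul_assoc]
    rw [← pow_succ, ← pow_succ']
  have hCsym : ∀ x y, inner ℝ (C x) y = inner ℝ x (C y) := by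
    intro x y
    have h1 : HasSum (fun n => inner ℝ (c n x) y) (inner ℝ (C x) y) := by
      have := hsum'.hasSum.mapL
        ((innerSL ℝ y : H →L[ℝ] ℝ).comp (ContinuousLinearMap.apply ℝ H x))
      simpa [real_inner_comm] using this
    have h2 : HasSum (fun n => inner ℝ x (c n y)) (inner ℝ x (C y)) := by
      have := hsum'.hasSum.mapL
        ((innerSL ℝ x : H →L[ℝ] ℝ).comp (ContinuousLinearMap.apply ℝ H y))
      simpa using this
    refine h1.unique ?_
    convert h2 using 2 with n
    simp only [hc, smul_apply, inner_smul_left, inner_smul_right, hsym_pow, conj_trivial]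
  have hquad : C = 1 + (1 / 4 : ℝ) • (K * (C * C)) := by
    have hCC : C * C = ∑' n, ((catalan (n + 1) : ℝ) * (1 / 4) ^ n) • K ^ n := by
      rw [hC, tsum_mul_tsum_eq_tsum_sum_antidiagonal_of_summable_norm hsum hsum]
      refine tsum_congr fun n => ?_
      rw [catalan_succ', Nat.cast_sum, Finset.sum_mul, Finset.sum_smul]
      refine Finset.sum_congr rfl fun p hp => ?_
      replace hp := Finset.HasAntidiagonal.mem_antidiagonal.mp hp
      simp only [hc, smul_mul_smul_comm, ← pow_add, hp]
      congr 1
      rw [← hp, pow_add]; push_cast; ring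
    have hs2 : Summable fun n : ℕ => ((catalan (n + 1) : ℝ) * (1 / 4) ^ n) • K ^ n := by
      have := (summable_norm_sum_mul_antidiagonal_of_summable_norm hsum hsum).of_norm
      refine this.congr fun n => ?_
      rw [catalan_succ', Nat.cast_sum, Finset.sum_mul, Finset.sum_smul]
      refine Finset.sum_congr rfl fun p hp => ?_
      replace hp := Finset.HasAntidiagonal.mem_antidiagonal.mp hp
      simp only [hc, smul_mul_smul_comm, ← pow_add, hp]
      congr 1
      rw [← hp, pow_add]; push_cast; ring
    conv_lhs => rw [hC, hsum'.tsum_eq_zero_add]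
    rw [hCC, ← hs2.tsum_mul_left, ← (hs2.mul_left K).tsum_const_smul]
    congr 1
    · simp [hc]
    · refine tsum_congr fun n => ?_
      simp only [hc, mul_smul_comm, smul_smul, ← pow_succ']
      congr 1
      ring
  refine ⟨1 - (1 / 2 : ℝ) • (K * C), ?_, ?_, ?_⟩
  · have hk : ∀ x y, inner ℝ (K x) y = inner ℝ x (K y) := by simpa using hsym_pow 1
    intro x y
    have : inner ℝ ((K * C) x) y = inner ℝ x ((K * C) y) := by
      conv_rhs => rw [hcomm]
      rw [mul_apply_eq_comp, mul_apply_eq_comp, hk, hCsym]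
    simp only [sub_apply, smul_apply, inner_sub_left,
      inner_sub_right, inner_smul_left, inner_smul_right, this]
    simp
  · intro x
    have h1 : ‖K * C‖ ≤ 2 := by
      calc ‖K * C‖ ≤ ‖K‖ * ‖C‖ := norm_mul_le _ _
        _ ≤ 1 * 2 := by gcongr
        _ = 2 := by norm_num
    have h2 : inner ℝ ((K * C) x) x ≤ 2 * ‖x‖ * ‖x‖ := by
      refine (real_inner_le_norm _ _).trans ?_
      gcongr
      exact ((K * C).le_opNorm x).trans (by gcongr)
    have h3 : inner ℝ x x = ‖x‖ * ‖x‖ := real_inner_self_eq_norm_mul_norm x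
    simp only [sub_apply, smul_apply, inner_sub_left,
      inner_smul_left, one_apply_eq_self]
    simp only [conj_trivial]
    linarith
  · have hkey : (1 - (1 / 2 : ℝ) • (K * C)) * (1 - (1 / 2 : ℝ) • (K * C)) = T := by
      have h4 : (K * C) * (K * C) = (4 : ℝ) • (K * C) - (4 : ℝ) • K := by
        have h5 : K * C = K + (1 / 4 : ℝ) • (K * (K * (C * C))) := by
          conv_lhs => rw [hquad]
          rw [mul_add, mul_one, mul_smul_comm]
        have h6 : (K * C) * (K * C) = K * (K * (C * C)) := by
          rw [mul_assoc, ← mul_assoc C K C, ← hcomm, mul_assoc]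
        have h7 : (1 / 4 : ℝ) • (K * (K * (C * C))) = K * C - K := eq_sub_of_add_eq' h5.symm
        rw [h6, ← smul_sub, ← h7, smul_smul]
        norm_num
      have h8 : T = 1 - K := by rw [hK]; abel
      rw [mul_sub, sub_mul, sub_mul, smul_mul_smul_comm, h4, h8]
      simp only [one_mul, mul_one]
      module
    intro x
    rw [← mul_apply_eq_comp, hkey]

section

variable {H : Type*} [NormedAddCommGroup H] [InnerProductSpace ℝ H] [CompleteSpace H]

theorem symm (A : CoerciveOperator H) (x y : A.op.domain) :
    inner ℝ (A.op x) (y : H) = inner ℝ (x : H) (A.op y) := by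
  have h := LinearPMap.adjoint_isFormalAdjoint A.dense_domain
  rw [LinearPMap.isSelfAdjoint_def.mp A.isSelfAdjoint] at h
  exact h x y

theorem surjective (A : CoerciveOperator H) (y : H) : ∃ x : A.op.domain, A.op x = y := by
  obtain ⟨α, hα, hco⟩ := A.coercive
  have hlow : ∀ x : A.op.domain, α * ‖(x : H)‖ ≤ ‖A.op x‖ := by
    intro x
    rcases eq_or_ne (x : H) 0 with hx | hx
    · simp [hx]
    · have h1 := (hco x).trans (real_inner_le_norm _ _)
      have h2 : 0 < ‖(x : H)‖ := norm_pos_iff.mpr hx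
      nlinarith
  set Rg : Submodule ℝ H := LinearMap.range A.op.toFun with hRg
  have hclosed : IsClosed (Rg : Set H) := by
    refine IsSeqClosed.isClosed fun s z hs hz => ?_
    choose x hx using hs
    have hx' : ∀ n, A.op (x n) = s n := hx
    have hcau : CauchySeq fun n => ((x n : A.op.domain) : H) := by
      rw [Metric.cauchySeq_iff']
      intro ε hε
      obtain ⟨N, hN⟩ := Metric.cauchySeq_iff'.mp hz.cauchySeq (α * ε) (by positivity)
      refine ⟨N, fun n hn => ?_⟩
      have h1 := hN n hn
      have h2 := hlow (x n - x N)
      rw [LinearPMap.map_sub, hx', hx', ← dist_eq_norm] at h2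
      have h3 : ‖((x n - x N : A.op.domain) : H)‖ = dist (x n : H) (x N : H) := by
        rw [dist_eq_norm]; rfl
      rw [h3] at h2
      exact lt_of_mul_lt_mul_left (h2.trans_lt h1) hα.le
    obtain ⟨w, hw⟩ := cauchySeq_tendsto_of_complete hcau
    have hg : (w, z) ∈ A.op.graph := by
      refine (A.isSelfAdjoint.isClosed : IsClosed (A.op.graph : Set (H × H))).mem_of_tendsto
        (hw.prodMk_nhds hz) (Filter.Eventually.of_forall fun n => ?_)
      rw [← hx' n]
      exact A.op.mem_graph (x n)
    obtain ⟨w', -, hw'⟩ := (LinearPMap.mem_graph_iff _).mp hg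
    exact ⟨w', hw'⟩
  have hperp : Rgᗮ = ⊥ := by
    rw [Submodule.eq_bot_iff]
    intro z hz
    have hz' : ∀ x : A.op.domain, inner ℝ (0 : H) (x : H) = inner ℝ z (A.op x) := by
      intro x
      rw [inner_zero_left]
      exact ((Submodule.mem_orthogonal' _ _).mp hz _ ⟨x, rfl⟩).symm
    have hzd : z ∈ A.op.adjoint.domain :=
      LinearPMap.mem_adjoint_domain_of_exists _ ⟨0, hz'⟩
    have hzd' : z ∈ A.op.domain := by
      rw [LinearPMap.isSelfAdjoint_def.mp A.isSelfAdjoint] at hzd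
      exact hzd
    have h0 : inner ℝ z (A.op ⟨z, hzd'⟩) = 0 := by
      rw [← hz' ⟨z, hzd'⟩, inner_zero_left]
    have h1 := hco ⟨z, hzd'⟩
    rw [real_inner_comm, h0] at h1
    have h2 : ‖z‖ ^ 2 ≤ 0 := by
      by_contra hcon
      push Not at hcon
      have : 0 < α * ‖z‖ ^ 2 := mul_pos hα hcon
      linarith
    have h3 : ‖z‖ = 0 := by nlinarith [norm_nonneg z]
    exact norm_eq_zero.mp h3
  have : CompleteSpace Rg := hclosed.completeSpace_coe
  have htop : Rg = ⊤ := (Submodule.orthogonal_eq_bot_iff).mp hperp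
  have : y ∈ Rg := by rw [htop]; trivial
  exact this

/-- A nonnegative self-adjoint square root of `A` exists. -/
theorem exists_sqrt (A : CoerciveOperator H) : ∃ R, IsPosSqrt A.op R := by
  obtain ⟨α, hα, hco⟩ := A.coercive
  choose g hg using A.surjective
  have hinj : ∀ x y : A.op.domain, A.op x = A.op y → x = y := by
    intro x y h
    have h1 := hco (x - y)
    rw [LinearPMap.map_sub, h, sub_self, inner_zero_left] at h1
    have h2 : ‖((x - y : A.op.domain) : H)‖ ^ 2 ≤ 0 := by
      by_contra hcon
      push Not at hcon
      have := mul_pos hα hcon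
      linarith
    have h3 : ‖((x - y : A.op.domain) : H)‖ = 0 := by
      nlinarith [norm_nonneg ((x - y : A.op.domain) : H)]
    have h4 : (x : H) - y = 0 := norm_eq_zero.mp h3
    exact Subtype.ext (sub_eq_zero.mp h4)
  have hbd : ∀ y, α * ‖(g y : H)‖ ^ 2 ≤ inner ℝ y (g y : H) := by
    intro y
    have := hco (g y)
    rwa [hg] at this
  have hbd' : ∀ y, α * ‖(g y : H)‖ ≤ ‖y‖ := by
    intro y
    rcases eq_or_ne (g y : H) 0 with hx | hx
    · simp [hx]
    · have h1 := (hbd y).trans (real_inner_le_norm _ _)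
      have h2 : 0 < ‖(g y : H)‖ := norm_pos_iff.mpr hx
      nlinarith
  let G₀ : H →ₗ[ℝ] H :=
    { toFun := fun y => (g y : H)
      map_add' := fun x y => by
        have : g (x + y) = g x + g y := hinj _ _ (by rw [LinearPMap.map_add, hg, hg, hg])
        rw [this]; rfl
      map_smul' := fun c x => by
        have : g (c • x) = c • g x := hinj _ _ (by rw [LinearPMap.map_smul, hg, hg])
        rw [this]; rfl }
  let G : H →L[ℝ] H := G₀.mkContinuous (α⁻¹) (fun y => by
    change ‖(g y : H)‖ ≤ α⁻¹ * ‖y‖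
    rw [inv_mul_eq_div, le_div_iff₀ hα, mul_comm]
    exact hbd' y)
  have hG : ∀ y, G y = (g y : H) := fun y => rfl
  have hGsym : ∀ x y, inner ℝ (G x) y = inner ℝ x (G y) := by
    intro x y
    have := A.symm (g x) (g y)
    rw [hg, hg] at this
    exact this.symm
  have hT1 : ‖(1 : H →L[ℝ] H) - α • G‖ ≤ 1 := by
    refine ContinuousLinearMap.opNorm_le_bound _ zero_le_one fun x => ?_
    have h1 := hbd x
    have h2 : ‖x - α • G x‖ ^ 2 ≤ ‖x‖ ^ 2 := by
      rw [norm_sub_sq_real, inner_smul_right, norm_smul, Real.norm_of_nonneg hα.le, hG]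
      have h3 : 0 ≤ inner ℝ x (g x : H) :=
        le_trans (by positivity) h1
      nlinarith [mul_le_mul_of_nonneg_left h1 hα.le, mul_nonneg hα.le h3]
    have h4 := (sq_le_sq₀ (norm_nonneg _) (norm_nonneg x)).mp h2
    simpa using h4
  obtain ⟨S, hSsym, hSpos, hSS⟩ := exists_bounded_sqrt (α • G)
    (fun x y => by simp [inner_smul_left, inner_smul_right, hGsym]) hT1
  have hGinj : ∀ x, G x = 0 → x = 0 := by
    intro x hx
    have h1 : g x = 0 := Subtype.ext hx
    rw [← hg x, h1, LinearPMap.map_zero]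
  have hSinj₀ : ∀ x, S x = 0 → x = 0 := by
    intro x hx
    apply hGinj
    have := hSS x
    rw [hx, map_zero, smul_apply] at this
    exact (smul_eq_zero.mp this.symm).resolve_left hα.ne'
  set β := √α with hβ
  have hβ0 : 0 < β := Real.sqrt_pos.mpr hα
  have hββ : β * β = α := Real.mul_self_sqrt hα.le
  set Q : H →L[ℝ] H := β⁻¹ • S with hQ
  have hQQ : ∀ x, Q (Q x) = G x := by
    intro x
    simp only [hQ, smul_apply, map_smul, hSS, smul_smul]
    rw [← hββ]
    have : β⁻¹ * (β⁻¹ * (β * β)) = 1 := by field_simp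
    rw [this, one_smul]
  have hQsym : ∀ x y, inner ℝ (Q x) y = inner ℝ x (Q y) := by
    intro x y
    simp [hQ, inner_smul_left, inner_smul_right, hSsym]
  have hQpos : ∀ x, 0 ≤ inner ℝ (Q x) x := by
    intro x
    simp only [hQ, smul_apply, inner_smul_left, conj_trivial]
    exact mul_nonneg (by positivity) (hSpos x)
  have hQinj : Function.Injective Q.toLinearMap := by
    rw [injective_iff_map_eq_zero]
    intro x hx
    apply hGinj
    rw [← hQQ]
    have : Q x = 0 := hx
    rw [this, map_zero]
  let e := LinearEquiv.ofInjective Q.toLinearMap hQinj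
  let R : H →ₗ.[ℝ] H := ⟨LinearMap.range Q.toLinearMap, e.symm.toLinearMap⟩
  have hRe : ∀ x, R (e x) = x := fun x => e.symm_apply_apply x
  have hRq : ∀ z : R.domain, Q (R z) = (z : H) := by
    intro z
    have : e (e.symm z) = z := e.apply_symm_apply z
    exact congrArg Subtype.val this
  have hgraph : ∀ x y : H, (x, y) ∈ R.graph ↔ x = Q y := by
    intro x y
    rw [LinearPMap.mem_graph_iff]
    constructor
    · rintro ⟨z, hz1, hz2⟩
      simp only at hz1 hz2
      rw [← hz1, ← hz2, hRq]
    · rintro rfl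
      exact ⟨e y, rfl, hRe y⟩
  have hdense : Dense (R.domain : Set H) := by
    change Dense ((LinearMap.range Q.toLinearMap : Submodule ℝ H) : Set H)
    rw [Submodule.dense_iff_topologicalClosure_eq_top,
      Submodule.topologicalClosure_eq_top_iff, Submodule.eq_bot_iff]
    intro z hz
    apply hGinj
    rw [← hQQ]
    have : Q z = 0 := by
      have h1 := (Submodule.mem_orthogonal' _ _).mp hz (Q (Q z)) ⟨Q z, rfl⟩
      rw [← hQsym] at h1
      exact inner_self_eq_zero.mp h1
    rw [this, map_zero]
  refine ⟨R, ?_, ?_, ?_⟩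
  · rw [LinearPMap.isSelfAdjoint_def]
    symm
    refine LinearPMap.eq_of_le_of_domain_eq
      (LinearPMap.IsFormalAdjoint.le_adjoint hdense fun x y => ?_) (le_antisymm ?_ ?_)
    · rw [← hRq x, ← hRq y, hRq, hRq]
      conv_lhs => rw [← hRq y]
      conv_rhs => rw [← hRq x]
      exact (hQsym _ _).symm
    · exact (LinearPMap.IsFormalAdjoint.le_adjoint hdense fun x y => by
        conv_lhs => rw [← hRq y]
        conv_rhs => rw [← hRq x]
        exact (hQsym _ _).symm).1
    · intro y hy
      refine ⟨R.adjoint ⟨y, hy⟩, ?_⟩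
      change Q (R.adjoint ⟨y, hy⟩) = y
      refine ext_inner_right ℝ fun v => ?_
      have h1 := LinearPMap.adjoint_isFormalAdjoint hdense ⟨y, hy⟩ (e v)
      rw [hRe] at h1
      rw [hQsym]
      exact h1
  · intro x
    conv_rhs => rw [← hRq x]
    rw [← hQsym]
    exact hQpos _
  · intro x y
    simp only [hgraph]
    rw [LinearPMap.mem_graph_iff]
    constructor
    · rintro ⟨z, hz1, hz2⟩
      simp only at hz1 hz2
      refine ⟨Q y, ?_, rfl⟩
      rw [hQQ, hG, ← hz1, ← hz2]
      exact congrArg Subtype.val (hinj _ _ (hg _).symm)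
    · rintro ⟨z, rfl, rfl⟩
      exact ⟨g y, by rw [hQQ]; rfl, hg y⟩

/-- The square root `A^{1/2}` (the nonnegative self-adjoint square root is unique). -/
noncomputable def sqrt (A : CoerciveOperator H) : H →ₗ.[ℝ] H := A.exists_sqrt.choose

theorem sqrt_spec (A : CoerciveOperator H) : IsPosSqrt A.op A.sqrt := A.exists_sqrt.choose_spec

theorem sqrt_symm (A : CoerciveOperator H) (x y : A.sqrt.domain) :
    inner ℝ (A.sqrt x) (y : H) = inner ℝ (x : H) (A.sqrt y) := by
  have h := LinearPMap.adjoint_isFormalAdjoint A.sqrt_spec.isSelfAdjoint.dense_domain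
  rw [LinearPMap.isSelfAdjoint_def.mp A.sqrt_spec.isSelfAdjoint] at h
  exact h x y

theorem sqrt_surjective (A : CoerciveOperator H) : Function.Surjective A.sqrt.toFun := by
  intro y
  obtain ⟨x, hx⟩ := A.surjective y
  have h : ((x : H), y) ∈ A.op.graph := by rw [← hx]; exact A.op.mem_graph x
  obtain ⟨z, -, hz⟩ := (A.sqrt_spec.comp_self _ _).mp h
  obtain ⟨z', -, hz'⟩ := (LinearPMap.mem_graph_iff _).mp hz
  exact ⟨z', hz'⟩

theorem sqrt_injective (A : CoerciveOperator H) : Function.Injective A.sqrt.toFun := by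
  rw [injective_iff_map_eq_zero]
  intro x hx
  refine Subtype.ext (ext_inner_right ℝ fun v => ?_)
  obtain ⟨y, rfl⟩ := A.sqrt_surjective v
  have h := A.sqrt_symm x y
  have hx' : A.sqrt x = 0 := hx
  rw [hx', inner_zero_left] at h
  change inner ℝ (x : H) (A.sqrt y) = inner ℝ (((0 : A.sqrt.domain)) : H) (A.sqrt y)
  rw [← h]; simp

theorem exists_bound_sqrt (A : CoerciveOperator H) :
    ∃ c : ℝ, ∀ x : A.sqrt.domain, ‖(x : H)‖ ≤ c * ‖A.sqrt x‖ := by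
  obtain ⟨α, hα, hco⟩ := A.coercive
  refine ⟨(√α)⁻¹, fun x => ?_⟩
  -- write `x = A^{1/2} y`, `y ∈ D(A)` up to one more preimage
  obtain ⟨a, ha⟩ := A.surjective (A.sqrt x)
  have h : ((a : H), A.sqrt x) ∈ A.op.graph := by rw [← ha]; exact A.op.mem_graph a
  obtain ⟨z, h1, h2⟩ := (A.sqrt_spec.comp_self _ _).mp h
  obtain ⟨z', hz', hz''⟩ := (LinearPMap.mem_graph_iff _).mp h2
  obtain ⟨a', ha', ha''⟩ := (LinearPMap.mem_graph_iff _).mp h1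
  simp only at hz' hz'' ha' ha''
  have hzx : z' = x := A.sqrt_injective hz''
  have hax : A.sqrt a' = (x : H) := by rw [ha'', ← hz', hzx]
  -- `‖x‖² = ⟪A a, a⟫ ≥ α ‖a‖²` and `‖x‖² ≤ ‖A^{1/2} x‖ ‖a‖`
  have e1 : inner ℝ (A.sqrt x) (a : H) = ‖(x : H)‖ ^ 2 := by
    rw [← ha', A.sqrt_symm, hax, real_inner_self_eq_norm_sq]
  have e2 : α * ‖(a : H)‖ ^ 2 ≤ ‖(x : H)‖ ^ 2 := by
    have := hco a
    rwa [ha, e1] at this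
  have e3 : ‖(x : H)‖ ^ 2 ≤ ‖A.sqrt x‖ * ‖(a : H)‖ := by
    rw [← e1]; exact real_inner_le_norm _ _
  have hβ0 : 0 < √α := Real.sqrt_pos.mpr hα
  have hββ : √α ^ 2 = α := Real.sq_sqrt hα.le
  have e4 : √α * ‖(a : H)‖ ≤ ‖(x : H)‖ := by
    refine (sq_le_sq₀ (by positivity) (norm_nonneg _)).mp ?_
    rw [mul_pow, hββ]; exact e2
  rw [inv_mul_eq_div, le_div_iff₀ hβ0]
  rcases eq_or_lt_of_le (norm_nonneg (x : H)) with hx | hx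
  · rw [← hx, zero_mul]; exact norm_nonneg _
  · have : ‖(x : H)‖ * (‖(x : H)‖ * √α) ≤ ‖(x : H)‖ * ‖A.sqrt x‖ := by
      nlinarith [norm_nonneg (A.sqrt x), mul_le_mul_of_nonneg_left e4 (norm_nonneg (A.sqrt x)),
        mul_le_mul_of_nonneg_left e3 hβ0.le]
    exact le_of_mul_le_mul_left this hx

end
end CoerciveOperator

section

variable {H : Type*} [NormedAddCommGroup H] [InnerProductSpace ℝ H] [CompleteSpace H]

/-- The space `V = D(A^{1/2})`, with `⟪u, v⟫_V = ⟪A^{1/2} u, A^{1/2} v⟫_H`. -/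
def EnergySpace (A : CoerciveOperator H) : Type _ := A.sqrt.domain

namespace EnergySpace

noncomputable instance (A : CoerciveOperator H) : AddCommGroup (EnergySpace A) :=
  inferInstanceAs (AddCommGroup A.sqrt.domain)

noncomputable instance (A : CoerciveOperator H) : Module ℝ (EnergySpace A) :=
  inferInstanceAs (Module ℝ A.sqrt.domain)

/-- The operator `A^{1/2} : V → H`. -/
noncomputable def sqrtMap (A : CoerciveOperator H) : EnergySpace A →ₗ[ℝ] H := A.sqrt.toFun

noncomputable instance (A : CoerciveOperator H) : NormedAddCommGroup (EnergySpace A) :=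
  NormedAddCommGroup.induced (EnergySpace A) H (sqrtMap A) A.sqrt_injective

noncomputable instance (A : CoerciveOperator H) : InnerProductSpace ℝ (EnergySpace A) :=
  InnerProductSpace.induced (sqrtMap A)

theorem norm_def (A : CoerciveOperator H) (v : EnergySpace A) : ‖v‖ = ‖sqrtMap A v‖ := rfl

theorem inner_def (A : CoerciveOperator H) (u v : EnergySpace A) :
    inner ℝ u v = inner ℝ (sqrtMap A u) (sqrtMap A v) := rfl

instance (A : CoerciveOperator H) : CompleteSpace (EnergySpace A) := by
  have hiso : Isometry (sqrtMap A) :=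
    AddMonoidHomClass.isometry_of_norm (sqrtMap A) fun v => (norm_def A v).symm
  have hsurj : Function.Surjective (sqrtMap A) := A.sqrt_surjective
  refine (completeSpace_iff_isComplete_range hiso.isUniformInducing).mpr ?_
  rw [hsurj.range_eq]
  exact isComplete_univ

/-- The embedding `V ↪ H`. -/
noncomputable def toH (A : CoerciveOperator H) : EnergySpace A →L[ℝ] H :=
  LinearMap.mkContinuousOfExistsBound (A.sqrt.domain.subtype : EnergySpace A →ₗ[ℝ] H)
    A.exists_bound_sqrt

/-- The embedding `H ≡ H' ↪ V'`, `h ↦ (φ ↦ ⟪h, φ⟫_H)`. -/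
noncomputable def ofH (A : CoerciveOperator H) (h : H) : StrongDual ℝ (EnergySpace A) :=
  (innerSL ℝ h).comp (toH A)

/-- The extension `A : V → V'`, `⟨A u, φ⟩ = ⟪A^{1/2} u, A^{1/2} φ⟫_H = ⟪u, φ⟫_V`. -/
noncomputable def opV (A : CoerciveOperator H) (u : EnergySpace A) :
    StrongDual ℝ (EnergySpace A) :=
  innerSL ℝ u

theorem toH_injective (A : CoerciveOperator H) : Function.Injective (toH A) :=
  Subtype.val_injective

/-- `opV` extends `A`. -/
theorem opV_eq (A : CoerciveOperator H) (u : EnergySpace A) (hu : toH A u ∈ A.op.domain) :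
    opV A u = ofH A (A.op ⟨toH A u, hu⟩) := by
  have hg := A.op.mem_graph ⟨toH A u, hu⟩
  obtain ⟨z, h1, h2⟩ := (A.sqrt_spec.comp_self _ _).mp hg
  obtain ⟨u', hu', rfl⟩ := (LinearPMap.mem_graph_iff _).mp h1
  obtain ⟨w, hw, hw'⟩ := (LinearPMap.mem_graph_iff _).mp h2
  obtain rfl : u' = u := Subtype.ext hu'
  ext φ
  change inner ℝ (A.sqrt u') (A.sqrt φ) = inner ℝ (A.op ⟨toH A u', hu⟩) (toH A φ)
  simp only at hw hw'
  rw [← hw', ← hw]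
  exact (A.sqrt_symm w φ).symm

end EnergySpace

end

open EnergySpace

/-- `w ∈ W^{1,p}(0,S;X)` with weak derivative `g` and initial value `x₀`: both `w` and `g` are in
`L^p(0,S;X)`, and `w` agrees almost everywhere with the absolutely continuous function
`t ↦ x₀ + ∫₀ᵗ g`. -/
def HasSobolevDeriv {X : Type*} [NormedAddCommGroup X] [NormedSpace ℝ X] (p : ENNReal) (S : ℝ)
    (x₀ : X) (w g : ℝ → X) : Prop :=
  MemLp w p (volume.restrict (Set.Ioo 0 S)) ∧
  MemLp g p (volume.restrict (Set.Ioo 0 S)) ∧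
  ∀ᵐ t ∂(volume.restrict (Set.Ioo 0 S)), w t = x₀ + ∫ s in (0 : ℝ)..t, g s

/-- The time interval `[0,T)`, where `T` may be `∞`. -/
def timeInterval (T : EReal) : Set ℝ := {t | 0 ≤ t ∧ (t : EReal) < T}

section

variable {H : Type*} [NormedAddCommGroup H] [InnerProductSpace ℝ H] [CompleteSpace H]

/-- The domain `D(L) = {(u, v) ∈ V × V : A u + B v ∈ H}` of
`L (u, v) = (-v, A u + B v)`. -/
def domL (A : CoerciveOperator H)
    (B : EnergySpace A →L[ℝ] StrongDual ℝ (EnergySpace A)) :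
    Set (EnergySpace A × EnergySpace A) :=
  {p | ∃ h : H, opV A p.1 + B p.2 = ofH A h}

/-- `u : [0,T) → V`, with time derivative `v : [0,T) → H`, is a weak solution of
`u_tt + A u + B u_t = f(u)`, `u(0) = u₀`, `u_t(0) = u₁`: for every finite `S` with `0 < S < T`,
`u ∈ L²(0,S;V) ∩ H¹(0,S;H)`, `f(u) ∈ L²(0,S;H)` and the equation, with `u_tt + B u_t` read as
the time derivative of `u_t + B u` (for `u_t(t) ∉ V` this is the meaning of `B u_t`), holds in
`L²(0,S;V')`. -/
structure IsWeakSolution (A : CoerciveOperator H)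
    (B : EnergySpace A →L[ℝ] StrongDual ℝ (EnergySpace A)) (f : EnergySpace A → H)
    (u₀ : EnergySpace A) (u₁ : H) (T : EReal) (u : ℝ → EnergySpace A) (v : ℝ → H) : Prop where
  memLp : ∀ S : ℝ, 0 < S → (S : EReal) < T →
    MemLp u 2 (volume.restrict (Set.Ioo 0 S))
  memLp_source : ∀ S : ℝ, 0 < S → (S : EReal) < T →
    MemLp (fun t => f (u t)) 2 (volume.restrict (Set.Ioo 0 S))
  deriv_eq : ∀ S : ℝ, 0 < S → (S : EReal) < T →
    HasSobolevDeriv 2 S (toH A u₀) (fun t => toH A (u t)) v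
  equation : ∀ S : ℝ, 0 < S → (S : EReal) < T →
    HasSobolevDeriv 2 S (ofH A u₁ + B u₀) (fun t => ofH A (v t) + B (u t))
      (fun t => ofH A (f (u t)) - opV A (u t))

/-- A weak solution with `(u, u_t) ∈ C([0,T); V × H)`. -/
structure IsContinuousWeakSolution (A : CoerciveOperator H)
    (B : EnergySpace A →L[ℝ] StrongDual ℝ (EnergySpace A)) (f : EnergySpace A → H)
    (u₀ : EnergySpace A) (u₁ : H) (T : EReal) (u : ℝ → EnergySpace A) (v : ℝ → H) : Prop where
  isWeakSolution : IsWeakSolution A B f u₀ u₁ T u v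
  continuousOn : ContinuousOn (fun t => (u t, v t)) (timeInterval T)
  initial : u 0 = u₀ ∧ v 0 = u₁

/-- `U = (u, v) : [0,T) → V × V` is a strong solution of `U_t + L U + (0, -f(u)) = 0`,
`U(0) = (u₀, u₁)`: `U ∈ W^{1,∞}(0,S;V × H)` for every finite `S` with `0 < S < T`, and for
almost every `t` one has `U(t) ∈ D(L)`, `u_t = v` and `v_t + A u + B v = f(u)`. -/
def IsStrongSolution (A : CoerciveOperator H)
    (B : EnergySpace A →L[ℝ] StrongDual ℝ (EnergySpace A)) (f : EnergySpace A → H)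
    (u₀ u₁ : EnergySpace A) (T : EReal) (u v : ℝ → EnergySpace A) : Prop :=
  ∃ a : ℝ → H, ∀ S : ℝ, 0 < S → (S : EReal) < T →
    HasSobolevDeriv ⊤ S u₀ u v ∧
    HasSobolevDeriv ⊤ S (toH A u₁) (fun t => toH A (v t)) a ∧
    ∀ᵐ t ∂(volume.restrict (Set.Ioo 0 S)),
      (u t, v t) ∈ domL A B ∧ ofH A (a t) + (opV A (u t) + B (v t)) = ofH A (f (u t))

/-- A strong solution in its representative with `(u, u_t) ∈ C([0,T); V × H)`. -/
structure IsContinuousStrongSolution (A : CoerciveOperator H)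
    (B : EnergySpace A →L[ℝ] StrongDual ℝ (EnergySpace A)) (f : EnergySpace A → H)
    (u₀ u₁ : EnergySpace A) (T : EReal) (u v : ℝ → EnergySpace A) : Prop where
  isStrongSolution : IsStrongSolution A B f u₀ u₁ T u v
  continuousOn : ContinuousOn (fun t => (u t, toH A (v t))) (timeInterval T)
  initial : u 0 = u₀ ∧ v 0 = u₁

/-- The energy `½ (‖u‖_V² + ‖v‖_H²) - 𝓕(u)` of a state `(u, v) ∈ V × H`. -/
noncomputable def energy (A : CoerciveOperator H) (F : EnergySpace A → ℝ)
    (u : EnergySpace A) (v : H) : ℝ :=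
  1 / 2 * (‖u‖ ^ 2 + ‖v‖ ^ 2) - F u

end

/-! ### Linear maximal monotone graphs, their resolvents and Yosida approximations -/

section MaximalMonotone

variable {X : Type*} [NormedAddCommGroup X] [InnerProductSpace ℝ X]

/-! In the phase space `V × H` the problem reads U' + LU = (0, f(u)) with L(u, v) = (-v, Au + Bv).
The operator L is maximal monotone: in ⟨L(u, v), (u, v)⟩ the terms ⟨u, v⟩_V cancel and ⟨Bv, v⟩ ≥ 0
remains, and the range condition is a Lax–Milgram problem in V (`isMaximalMonotoneGraph_waveGraph`).
Hence -L generates a contraction semigroup, obtained here from Yosida approximations, and variation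
of constants solves the linear inhomogeneous equation.

All linear theory is phrased through one integrated identity: the pair (∫₀ᵗ U, x - U(t) + ∫₀ᵗ G)
lies in the graph of L. It makes sense for merely continuous U, it is stable under limits because
the graph is closed, and it has unique solutions because the primitive W of a difference satisfies
W' + LW = 0, W(0) = 0. In components it is exactly the weak formulation, with B acting on u(t) - u₀
instead of u_t (`integral_mem_waveGraph_iff`).

A globally Lipschitz nonlinearity is handled by a fixed point in an exponentially weighted norm
(`exists_semilinear`). For the given f, only Lipschitz on balls, f is composed with the radial
retraction of V onto a ball of radius K. Since 𝓕 ≤ 0, the assumed energy estimate bounds ‖u‖_V by a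
number R depending only on C and the data. With K > R the truncated solution never reaches the
sphere of radius K, so it solves the original equation for all times
(`exists_global_of_apriori_bound`).

If the data lie in D(L), comparing U with its time translates shows that U is locally Lipschitz in
time. A Lipschitz curve in a Hilbert space is the integral of its bounded a.e. derivative, and this
turns the integrated equation into the strong one. For uniqueness, every weak solution agrees a.e.
with a continuous integrated solution, strong solutions are weak, and two continuous integrated
solutions coincide by Grönwall on a ball containing both. -/

/-- `M` is the graph of a (single-valued) maximal monotone linear operator on the Hilbert
space `X`. -/
structure IsMaximalMonotoneGraph (M : Submodule ℝ (X × X)) : Prop where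
  nonneg : ∀ p ∈ M, 0 ≤ inner ℝ p.1 p.2
  exists_add_smul : ∀ c : ℝ, 0 < c → ∀ z : X, ∃ p ∈ M, p.1 + c • p.2 = z
  eq_zero : ∀ y : X, ((0 : X), y) ∈ M → y = 0

theorem norm_le_of_inner_deriv_nonpos {w w' : ℝ → X}
    (hw : ∀ t, HasDerivAt w (w' t) t) (h : ∀ t, 0 ≤ t → inner ℝ (w t) (w' t) ≤ 0)
    {t : ℝ} (ht : 0 ≤ t) : ‖w t‖ ≤ ‖w 0‖ := by
  have hd : ∀ t, HasDerivAt (fun s => ‖w s‖ ^ 2) (2 * inner ℝ (w t) (w' t)) t :=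
    fun t => (hw t).norm_sq
  have hanti : AntitoneOn (fun s => ‖w s‖ ^ 2) (Set.Ici 0) := by
    refine antitoneOn_of_deriv_nonpos (convex_Ici 0)
      (fun t _ => (hd t).continuousAt.continuousWithinAt)
      (fun t _ => (hd t).differentiableAt.differentiableWithinAt) fun t ht => ?_
    rw [interior_Ici] at ht
    rw [(hd t).deriv]
    linarith [h t (le_of_lt ht)]
  exact (sq_le_sq₀ (norm_nonneg _) (norm_nonneg _)).mp
    (hanti (Set.self_mem_Ici) (Set.mem_Ici.mpr ht) ht)

namespace IsMaximalMonotoneGraph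

variable {M : Submodule ℝ (X × X)}

/-- In the expanded square the cross term 2c⟨p.1, p.2⟩ is nonnegative. So I + cL is injective with
nonexpansive inverse. -/
theorem norm_fst_le (hM : IsMaximalMonotoneGraph M) {c : ℝ} (hc : 0 ≤ c) {p : X × X}
    (hp : p ∈ M) : ‖p.1‖ ≤ ‖p.1 + c • p.2‖ := by
  have h0 := hM.nonneg p hp
  have h1 : ‖p.1‖ ^ 2 ≤ ‖p.1 + c • p.2‖ ^ 2 := by
    rw [norm_add_sq_real, inner_smul_right]
    have := mul_nonneg hc h0
    nlinarith [sq_nonneg ‖c • p.2‖]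
  exact (sq_le_sq₀ (norm_nonneg _) (norm_nonneg _)).mp h1

theorem eq_of_add_smul_eq (hM : IsMaximalMonotoneGraph M) {c : ℝ} (hc : 0 ≤ c) {p q : X × X}
    (hp : p ∈ M) (hq : q ∈ M) (h : p.1 + c • p.2 = q.1 + c • q.2) : p.1 = q.1 := by
  have h1 := hM.norm_fst_le hc (M.sub_mem hp hq)
  have h2 : (p - q).1 + c • (p - q).2 = 0 := by
    rw [Prod.fst_sub, Prod.snd_sub, smul_sub, sub_add_sub_comm, h, sub_self]
  rw [h2, norm_zero, norm_le_zero_iff] at h1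
  exact sub_eq_zero.mp h1

/-- J is the resolvent (I + cL)⁻¹. It is everywhere defined by the range condition; uniqueness from
`norm_fst_le` makes it linear and a contraction. The first clause says that c⁻¹(z - Jz), the Yosida
approximation at z, equals L(Jz). -/
theorem exists_resolvent (hM : IsMaximalMonotoneGraph M) {c : ℝ} (hc : 0 < c) :
    ∃ J : X →L[ℝ] X, (∀ z, (J z, c⁻¹ • (z - J z)) ∈ M) ∧ (∀ z, ‖J z‖ ≤ ‖z‖) ∧
      ∀ p ∈ M, J (p.1 + c • p.2) = p.1 := by
  choose P hPM hP using hM.exists_add_smul c hc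
  have huniq : ∀ p ∈ M, (P (p.1 + c • p.2)).1 = p.1 := fun p hp =>
    hM.eq_of_add_smul_eq hc.le (hPM _) hp (hP _)
  let J₀ : X →ₗ[ℝ] X :=
    { toFun := fun z => (P z).1
      map_add' := fun x y => by
        have := huniq _ (M.add_mem (hPM x) (hPM y))
        rwa [Prod.fst_add, Prod.snd_add, smul_add, add_add_add_comm, hP, hP] at this
      map_smul' := fun a x => by
        have := huniq _ (M.smul_mem a (hPM x))
        rwa [Prod.smul_fst, Prod.smul_snd, smul_comm c a, ← smul_add, hP] at this }
  have hn : ∀ z, ‖J₀ z‖ ≤ 1 * ‖z‖ := fun z => by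
    have := hM.norm_fst_le hc.le (hPM z)
    rw [hP] at this
    rwa [one_mul]
  refine ⟨J₀.mkContinuous 1 hn, fun z => ?_, fun z => by simpa using hn z, huniq⟩
  have h1 : c⁻¹ • (z - (P z).1) = (P z).2 := by
    nth_rewrite 1 [← hP z]
    rw [add_sub_cancel_left, smul_smul, inv_mul_cancel₀ hc.ne', one_smul]
  change ((P z).1, c⁻¹ • (z - (P z).1)) ∈ M
  rw [h1]
  exact hPM z

/-- Membership in the unbounded graph becomes an equation for one bounded operator. Closedness,
stability under Bochner integration and stability under weak limits are all read off from it. -/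
theorem exists_resolvent_one (hM : IsMaximalMonotoneGraph M) :
    ∃ J : X →L[ℝ] X, ∀ x y, (x, y) ∈ M ↔ J (x + y) = x := by
  obtain ⟨J, h1, -, h3⟩ := hM.exists_resolvent one_pos
  refine ⟨J, fun x y => ⟨fun h => by simpa using h3 _ h, fun h => ?_⟩⟩
  have := h1 (x + y)
  rwa [h, inv_one, one_smul, add_sub_cancel_left] at this

theorem isClosed (hM : IsMaximalMonotoneGraph M) : IsClosed (M : Set (X × X)) := by
  obtain ⟨J, hJ⟩ := hM.exists_resolvent_one
  have : (M : Set (X × X)) = {p | J (p.1 + p.2) = p.1} := by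
    ext p; exact hJ p.1 p.2
  rw [this]
  exact isClosed_eq (by fun_prop) (by fun_prop)

/-- The equation J(x + y) = x survives integration because J is bounded; this is Hille's theorem for
the closed operator L. -/
theorem integral_mem [CompleteSpace X] (hM : IsMaximalMonotoneGraph M) {α : Type*}
    [MeasurableSpace α]
    {μ : Measure α} {x y : α → X} (hx : Integrable x μ) (hy : Integrable y μ)
    (h : ∀ᵐ s ∂μ, (x s, y s) ∈ M) : (∫ s, x s ∂μ, ∫ s, y s ∂μ) ∈ M := by
  obtain ⟨J, hJ⟩ := hM.exists_resolvent_one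
  rw [hJ, ← integral_add hx hy, ← J.integral_comp_comm (φ := fun s => x s + y s) (hx.add hy)]
  refine integral_congr_ae ?_
  filter_upwards [h] with s hs
  exact (hJ _ _).mp hs

theorem intervalIntegral_mem [CompleteSpace X] (hM : IsMaximalMonotoneGraph M) {x y : ℝ → X}
    {a b : ℝ}
    (hab : a ≤ b) (hx : IntervalIntegrable x volume a b) (hy : IntervalIntegrable y volume a b)
    (h : ∀ᵐ s ∂(volume.restrict (Set.Ioc a b)), (x s, y s) ∈ M) :
    (∫ s in a..b, x s, ∫ s in a..b, y s) ∈ M := by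
  rw [intervalIntegral.integral_of_le hab, intervalIntegral.integral_of_le hab]
  exact hM.integral_mem ((intervalIntegrable_iff_integrableOn_Ioc_of_le hab).mp hx)
    ((intervalIntegrable_iff_integrableOn_Ioc_of_le hab).mp hy) h

/-- The domain of a maximal monotone operator is dense. -/
theorem dense_domain [CompleteSpace X] (hM : IsMaximalMonotoneGraph M) :
    Dense {x : X | ∃ y, (x, y) ∈ M} := by
  set D : Submodule ℝ X := M.map (LinearMap.fst ℝ X X) with hD
  have hmem : ∀ x, x ∈ D ↔ ∃ y, (x, y) ∈ M := by
    intro x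
    simp [hD]
  have : {x : X | ∃ y, (x, y) ∈ M} = (D : Set X) := by
    ext x; exact (hmem x).symm
  rw [this, Submodule.dense_iff_topologicalClosure_eq_top,
    ← Submodule.orthogonal_eq_bot_iff, Submodule.orthogonal_closure, Submodule.eq_bot_iff]
  intro z hz
  -- For z orthogonal to the domain, write z = p.1 + p.2. Pairing with p.1 gives ‖p.1‖² + ⟨p.1, p.2⟩
  -- = 0, so p.1 = 0 by monotonicity, and p.2 = 0 by single-valuedness.
  obtain ⟨p, hp, hpz⟩ := hM.exists_add_smul 1 one_pos z
  rw [one_smul] at hpz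
  have h1 : inner ℝ p.1 z = 0 :=
    (Submodule.mem_orthogonal _ _).mp hz _ ((hmem _).mpr ⟨p.2, hp⟩)
  have h2 := hM.nonneg p hp
  rw [← hpz, inner_add_right, real_inner_self_eq_norm_sq] at h1
  have h3 : p.1 = 0 := by
    have : ‖p.1‖ ^ 2 = 0 := le_antisymm (by linarith) (by positivity)
    simpa using this
  have h4 : p.2 = 0 := hM.eq_zero _ (by rw [← h3]; exact hp)
  rw [← hpz, h3, h4, add_zero]

/-- Solutions of the Yosida-regularized equation. -/
theorem exists_yosida [CompleteSpace X] (hM : IsMaximalMonotoneGraph M) {x y : X}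
    (hxy : (x, y) ∈ M) {c : ℝ} (hc : 0 < c) :
    ∃ u a : ℝ → X, u 0 = x ∧ Continuous a ∧ (∀ t, HasDerivAt u (-(a t)) t) ∧
      (∀ t, (u t - c • a t, a t) ∈ M) ∧ (∀ t, 0 ≤ t → ‖a t‖ ≤ ‖y‖) ∧
      ∀ t, 0 ≤ t → ‖u t‖ ≤ ‖x‖ := by
  obtain ⟨J, h1, h2, h3⟩ := hM.exists_resolvent hc
  -- The Yosida approximation is bounded, so its flow is an operator exponential.
  set L : X →L[ℝ] X := c⁻¹ • (1 - J) with hL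
  have hLz : ∀ z, L z = c⁻¹ • (z - J z) := fun z => rfl
  have hJL : ∀ z, z - c • L z = J z := by
    intro z
    rw [hLz, smul_smul, mul_inv_cancel₀ hc.ne', one_smul, sub_sub_cancel]
  have hLmem : ∀ z, (z - c • L z, L z) ∈ M := fun z => by rw [hJL, hLz]; exact h1 z
  have hLpos : ∀ z, 0 ≤ inner ℝ z (L z) := by
    intro z
    have h4 := hM.nonneg _ (hLmem z)
    simp only [inner_sub_left, inner_smul_left, conj_trivial] at h4
    have h5 : 0 ≤ c * inner ℝ (L z) (L z) := mul_nonneg hc.le real_inner_self_nonneg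
    linarith
  set u : ℝ → X := fun t => NormedSpace.exp (t • (-L)) x with hu
  have hu' : ∀ t, HasDerivAt u (-(L (u t))) t := by
    intro t
    have h4 := (hasDerivAt_exp_smul_const' (𝕂 := ℝ) (-L) t).clm_apply (hasDerivAt_const t x)
    simpa [hu] using h4
  have hu0 : u 0 = x := by simp [hu]
  have ha' : ∀ t, HasDerivAt (fun t => L (u t)) (-(L (L (u t)))) t := by
    intro t
    have h4 := L.hasFDerivAt.comp_hasDerivAt t (hu' t)
    rwa [map_neg] at h4
  refine ⟨u, fun t => L (u t), hu0, ?_, hu', fun t => hLmem _, fun t ht => ?_, fun t ht => ?_⟩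
  · exact continuous_iff_continuousAt.mpr fun t => (ha' t).continuousAt
  · refine (norm_le_of_inner_deriv_nonpos ha' (fun t _ => ?_) ht).trans ?_
    · rw [inner_neg_right]
      linarith [hLpos (L (u t))]
    -- On the domain of the generator the Yosida approximation is J applied to the true value y.
    -- Hence the initial speed is at most ‖y‖, uniformly in c.
    · have h4 : L x = J y := by
        have h5 := h3 _ hxy
        simp only [map_add, map_smul] at h5
        rw [hLz]
        nth_rewrite 1 [← h5]
        rw [add_sub_cancel_left, smul_smul, inv_mul_cancel₀ hc.ne', one_smul]
      rw [hu0, h4]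
      exact h2 y
  · rw [← hu0]
    refine norm_le_of_inner_deriv_nonpos hu' (fun t _ => ?_) ht
    rw [inner_neg_right]
    linarith [hLpos (u t)]

/-- The derivative of ‖u - u'‖² is -2⟨u - u', a - a'⟩. Replacing u, u' by u - ca, u' - c'a' makes
the main term nonpositive by monotonicity. The error 2|⟨ca - c'a', a - a'⟩| is at most 2 · (c + c')b
· 2b, the slope in the bound. -/
theorem yosida_sub_le (hM : IsMaximalMonotoneGraph M) {u a u' a' : ℝ → X} {c c' b : ℝ}
    (hc : 0 < c) (hc' : 0 < c') (h0 : u 0 = u' 0)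
    (hu : ∀ t, HasDerivAt u (-(a t)) t) (hu' : ∀ t, HasDerivAt u' (-(a' t)) t)
    (ha : ∀ t, (u t - c • a t, a t) ∈ M) (ha' : ∀ t, (u' t - c' • a' t, a' t) ∈ M)
    (hb : ∀ t, 0 ≤ t → ‖a t‖ ≤ b) (hb' : ∀ t, 0 ≤ t → ‖a' t‖ ≤ b) {t : ℝ} (ht : 0 ≤ t) :
    ‖u t - u' t‖ ^ 2 ≤ 4 * (c + c') * b ^ 2 * t := by
  have hd : ∀ t, HasDerivAt (fun s => ‖u s - u' s‖ ^ 2 - 4 * (c + c') * b ^ 2 * s)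
      (2 * inner ℝ (u t - u' t) (-(a t) - -(a' t)) - 4 * (c + c') * b ^ 2) t := by
    intro t
    have h1 := ((hu t).sub (hu' t)).norm_sq
    have h2 := (hasDerivAt_id t).const_mul (4 * (c + c') * b ^ 2)
    rw [mul_one] at h2
    exact h1.sub h2
  have hanti : AntitoneOn (fun s => ‖u s - u' s‖ ^ 2 - 4 * (c + c') * b ^ 2 * s)
      (Set.Ici 0) := by
    refine antitoneOn_of_deriv_nonpos (convex_Ici 0)
      (fun t _ => (hd t).continuousAt.continuousWithinAt)
      (fun t _ => (hd t).differentiableAt.differentiableWithinAt) fun t ht => ?_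
    rw [interior_Ici] at ht
    rw [(hd t).deriv]
    have ht0 : 0 ≤ t := le_of_lt ht
    have e1 := hM.nonneg _ (M.sub_mem (ha t) (ha' t))
    have hb0 : 0 ≤ b := (norm_nonneg _).trans (hb t ht0)
    have e2 : |inner ℝ (c • a t - c' • a' t) (a t - a' t)| ≤ (c * b + c' * b) * (b + b) := by
      refine (abs_real_inner_le_norm _ _).trans ?_
      have e3 : ‖c • a t - c' • a' t‖ ≤ c * b + c' * b := by
        refine (norm_sub_le _ _).trans ?_
        rw [norm_smul, norm_smul, Real.norm_of_nonneg hc.le, Real.norm_of_nonneg hc'.le]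
        gcongr
        · exact hb t ht0
        · exact hb' t ht0
      have e4 : ‖a t - a' t‖ ≤ b + b :=
        (norm_sub_le _ _).trans (add_le_add (hb t ht0) (hb' t ht0))
      gcongr
    have e5 : inner ℝ (u t - u' t) (-(a t) - -(a' t)) =
        -(inner ℝ ((u t - c • a t) - (u' t - c' • a' t)) (a t - a' t)) -
          inner ℝ (c • a t - c' • a' t) (a t - a' t) := by
      rw [← inner_neg_left, ← inner_sub_left, ← neg_neg (-(a t) - -(a' t)), inner_neg_right,
        ← inner_neg_left]
      congr 1 <;> abel
    rw [e5]
    have e6 := neg_abs_le (inner ℝ (c • a t - c' • a' t) (a t - a' t) : ℝ)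
    simp only [Prod.fst_sub, Prod.snd_sub] at e1
    nlinarith
  have h1 := hanti (Set.self_mem_Ici) (Set.mem_Ici.mpr ht) ht
  simp only [h0, sub_self, norm_zero] at h1
  linarith

end IsMaximalMonotoneGraph
end MaximalMonotone

/-! ### The integrated linear equation and the contraction semigroup -/

section IntegralSolution

variable {X : Type*} [NormedAddCommGroup X] [InnerProductSpace ℝ X]

/-- `U` is a (continuous) solution of `U' + L U = G`, `U 0 = x` on `[0, T]`, in time-integrated
form, where `M` is the graph of `L`. -/
structure IsIntegralSolution (M : Submodule ℝ (X × X)) (T : ℝ) (x : X) (G U : ℝ → X) :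
    Prop where
  continuous : Continuous U
  mem : ∀ t ∈ Set.Icc 0 T, (∫ s in (0 : ℝ)..t, U s, x - U t + ∫ s in (0 : ℝ)..t, G s) ∈ M

namespace IsIntegralSolution

variable {M : Submodule ℝ (X × X)} {T : ℝ} {x x' : X} {G G' U U' : ℝ → X}

theorem mono (h : IsIntegralSolution M T x G U) {S : ℝ} (hS : S ≤ T) :
    IsIntegralSolution M S x G U :=
  ⟨h.continuous, fun t ht => h.mem t ⟨ht.1, ht.2.trans hS⟩⟩

theorem sub (h : IsIntegralSolution M T x G U) (h' : IsIntegralSolution M T x' G' U')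
    (hG : IntervalIntegrable G volume 0 T) (hG' : IntervalIntegrable G' volume 0 T) :
    IsIntegralSolution M T (x - x') (fun t => G t - G' t) (fun t => U t - U' t) := by
  refine ⟨h.continuous.sub h'.continuous, fun t ht => ?_⟩
  have hsub : Set.uIcc 0 t ⊆ Set.uIcc 0 T := by
    rw [Set.uIcc_of_le ht.1, Set.uIcc_of_le (ht.1.trans ht.2)]
    exact Set.Icc_subset_Icc le_rfl ht.2
  have := M.sub_mem (h.mem t ht) (h'.mem t ht)
  rw [intervalIntegral.integral_sub (h.continuous.intervalIntegrable _ _)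
    (h'.continuous.intervalIntegrable _ _), intervalIntegral.integral_sub
    (hG.mono_set hsub) (hG'.mono_set hsub)]
  convert this using 1
  simp only [Prod.mk_sub_mk]
  congr 1
  abel

theorem congr_source (h : IsIntegralSolution M T x G U)
    (hG : ∀ᵐ t ∂(volume.restrict (Set.Ioc 0 T)), G t = G' t) :
    IsIntegralSolution M T x G' U := by
  refine ⟨h.continuous, fun t ht => ?_⟩
  have : ∫ s in (0 : ℝ)..t, G' s = ∫ s in (0 : ℝ)..t, G s := by
    rw [intervalIntegral.integral_of_le ht.1, intervalIntegral.integral_of_le ht.1]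
    refine integral_congr_ae ?_
    filter_upwards [ae_restrict_of_ae_restrict_of_subset
      (Set.Ioc_subset_Ioc_right ht.2) hG] with s hs using hs.symm
  rw [this]
  exact h.mem t ht

/-- Increments of the integrated equation over [t, t + h], divided by h. The averages of U always
lie in the domain of L, which is the source of all pointwise regularity later on. -/
theorem average_mem (hU : IsIntegralSolution M T x G U) (hG : Continuous G) {t h : ℝ}
    (ht : 0 ≤ t) (hh : 0 < h) (hth : t + h ≤ T) :
    (h⁻¹ • ∫ s in t..t + h, U s,
      h⁻¹ • (∫ s in t..t + h, G s) - h⁻¹ • (U (t + h) - U t)) ∈ M := by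
  have h1 := M.smul_mem h⁻¹ (M.sub_mem (hU.mem (t + h) ⟨by positivity, hth⟩)
    (hU.mem t ⟨ht, by linarith⟩))
  rw [← intervalIntegral.integral_interval_sub_left (hU.continuous.intervalIntegrable 0 _)
      (hU.continuous.intervalIntegrable 0 _),
    ← intervalIntegral.integral_interval_sub_left (hG.intervalIntegrable 0 _)
      (hG.intervalIntegrable 0 _), ← smul_sub]
  convert h1 using 1
  simp only [Prod.mk_sub_mk, Prod.smul_mk]
  congr 2
  abel

end IsIntegralSolution

namespace IsMaximalMonotoneGraph

variable [CompleteSpace X] {M : Submodule ℝ (X × X)}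

/-- The primitive W of U satisfies W' + LW = 0 and W(0) = 0, so ‖W‖² is nonincreasing from zero. -/
theorem primitive_eq_zero (hM : IsMaximalMonotoneGraph M) {T : ℝ} {U : ℝ → X}
    (hU : Continuous U) (h : ∀ t ∈ Set.Icc 0 T, (∫ s in (0 : ℝ)..t, U s, -U t) ∈ M)
    {t : ℝ} (ht : t ∈ Set.Icc 0 T) : ∫ s in (0 : ℝ)..t, U s = 0 := by
  have hd : ∀ t, HasDerivAt (fun r => ‖∫ s in (0 : ℝ)..r, U s‖ ^ 2)
      (2 * inner ℝ (∫ s in (0 : ℝ)..t, U s) (U t)) t := fun t =>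
    (hU.integral_hasStrictDerivAt 0 t).hasDerivAt.norm_sq
  have hanti : AntitoneOn (fun r => ‖∫ s in (0 : ℝ)..r, U s‖ ^ 2) (Set.Icc 0 T) := by
    refine antitoneOn_of_deriv_nonpos (convex_Icc 0 T)
      (fun t _ => (hd t).continuousAt.continuousWithinAt)
      (fun t _ => (hd t).differentiableAt.differentiableWithinAt) fun t ht => ?_
    rw [interior_Icc] at ht
    rw [(hd t).deriv]
    have := hM.nonneg _ (h t ⟨ht.1.le, ht.2.le⟩)
    rw [inner_neg_right] at this
    linarith
  have h1 := hanti ⟨le_rfl, ht.1.trans ht.2⟩ ht ht.1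
  simp only [intervalIntegral.integral_same, norm_zero] at h1
  have h2 : ‖∫ s in (0 : ℝ)..t, U s‖ ^ 2 = 0 := le_antisymm (by simpa using h1) (by positivity)
  simpa using h2

/-- The primitive of the difference vanishes, so the graph contains (0, -(U t - U' t)), and
single-valuedness concludes. -/
theorem integralSolution_unique (hM : IsMaximalMonotoneGraph M) {T : ℝ} {x : X}
    {G U U' : ℝ → X} (hU : IsIntegralSolution M T x G U) (hU' : IsIntegralSolution M T x G U')
    {t : ℝ} (ht : t ∈ Set.Icc 0 T) : U t = U' t := by
  have hc : Continuous fun s => U s - U' s := hU.continuous.sub hU'.continuous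
  have hmem : ∀ t ∈ Set.Icc 0 T, (∫ s in (0 : ℝ)..t, (U s - U' s), -(U t - U' t)) ∈ M := by
    intro t ht
    have := M.sub_mem (hU.mem t ht) (hU'.mem t ht)
    rw [intervalIntegral.integral_sub (hU.continuous.intervalIntegrable _ _)
      (hU'.continuous.intervalIntegrable _ _)]
    convert this using 1
    simp only [Prod.mk_sub_mk]
    congr 1
    abel
  have h0 := hmem t ht
  rw [hM.primitive_eq_zero hc hmem ht] at h0
  have := hM.eq_zero _ h0
  rwa [neg_eq_zero, sub_eq_zero] at this

open Filter Topology in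
-- The Yosida solutions with c = 1/(n + 1) form a Cauchy sequence at each time by `yosida_sub_le`.
-- Their speeds are bounded by ‖y‖, so the limit is Lipschitz, and closedness of the graph carries
-- the integrated equation over.
theorem exists_homogeneous_of_mem (hM : IsMaximalMonotoneGraph M) {x y : X}
    (hxy : (x, y) ∈ M) :
    ∃ U : ℝ → X, Continuous U ∧ (∀ t, ‖U t‖ ≤ ‖x‖) ∧
      ∀ t, 0 ≤ t → (∫ s in (0 : ℝ)..t, U s, x - U t) ∈ M := by
  set c : ℕ → ℝ := fun n => 1 / ((n : ℝ) + 1) with hc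
  have hc0 : ∀ n, 0 < c n := fun n => by positivity
  have hclim : Tendsto c atTop (𝓝 0) := tendsto_one_div_add_atTop_nhds_zero_nat
  choose u a hu0 hac hu hmem ha hun using fun n => hM.exists_yosida hxy (hc0 n)
  have hcont : ∀ n, Continuous (u n) := fun n =>
    continuous_iff_continuousAt.mpr fun t => (hu n t).continuousAt
  have hcau : ∀ t, 0 ≤ t → CauchySeq fun n => u n t := by
    intro t ht
    rw [Metric.cauchySeq_iff]
    intro ε hε
    have hl : Tendsto (fun n => 8 * c n * ‖y‖ ^ 2 * t) atTop (𝓝 0) := by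
      simpa using ((hclim.const_mul 8).mul_const (‖y‖ ^ 2)).mul_const t
    obtain ⟨N, hN⟩ := (hl.eventually (gt_mem_nhds (show (0 : ℝ) < ε ^ 2 by positivity))).exists
    refine ⟨N, fun m hm n hn => ?_⟩
    have h1 := hM.yosida_sub_le (hc0 m) (hc0 n) ((hu0 m).trans (hu0 n).symm) (hu m) (hu n)
      (hmem m) (hmem n) (ha m) (ha n) ht
    have hmono : ∀ k, N ≤ k → c k ≤ c N := fun k hk => by
      simp only [hc]
      gcongr
    have h2 : 4 * (c m + c n) * ‖y‖ ^ 2 * t ≤ 8 * c N * ‖y‖ ^ 2 * t := by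
      gcongr ?_ * _ * _
      linarith [hmono m hm, hmono n hn]
    rw [dist_eq_norm]
    exact (sq_lt_sq₀ (norm_nonneg _) hε.le).mp (by linarith)
  -- The estimates hold for t ≥ 0 only; freezing the limit at negative times keeps it continuous on
  -- the whole line.
  choose V hV using fun t : ℝ => cauchySeq_tendsto_of_complete (hcau (max t 0) (le_max_right _ _))
  have hVt : ∀ t, 0 ≤ t → Tendsto (fun n => u n t) atTop (𝓝 (V t)) := fun t ht => by
    simpa [max_eq_left ht] using hV t
  have hulip : ∀ n s t, 0 ≤ s → 0 ≤ t → ‖u n s - u n t‖ ≤ ‖y‖ * ‖s - t‖ := by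
    intro n s t hs ht
    exact (convex_Ici (0 : ℝ)).norm_image_sub_le_of_norm_hasDerivWithin_le
      (fun r _ => (hu n r).hasDerivWithinAt)
      (fun r hr => by rw [norm_neg]; exact ha n r hr) ht hs
  have hVc : Continuous V := by
    refine (LipschitzWith.of_dist_le_mul (K := ‖y‖₊) fun s t => ?_).continuous
    refine le_of_tendsto ((hV s).dist (hV t)) (Eventually.of_forall fun n => ?_)
    rw [dist_eq_norm, Real.dist_eq]
    refine (hulip n _ _ (le_max_right _ _) (le_max_right _ _)).trans ?_
    rw [coe_nnnorm, Real.norm_eq_abs]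
    exact mul_le_mul_of_nonneg_left (abs_max_sub_max_le_abs s t 0) (norm_nonneg y)
  refine ⟨V, hVc, fun t => ?_, fun t ht => ?_⟩
  · exact le_of_tendsto (hV t).norm (Eventually.of_forall fun n => hun n _ (le_max_right _ _))
  have hmemn : ∀ n, (∫ s in (0 : ℝ)..t, (u n s - c n • a n s), x - u n t) ∈ M := by
    intro n
    have h1 : ∫ s in (0 : ℝ)..t, a n s = x - u n t := by
      have h2 := intervalIntegral.integral_eq_sub_of_hasDerivAt (fun r _ => hu n r)
        ((hac n).neg.intervalIntegrable 0 t)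
      rw [intervalIntegral.integral_neg, hu0] at h2
      rw [← neg_neg (∫ s in (0 : ℝ)..t, a n s), h2, neg_sub]
    rw [← h1]
    exact hM.intervalIntegral_mem ht
      (((hcont n).sub ((hac n).const_smul (c n))).intervalIntegrable _ _)
      ((hac n).intervalIntegrable _ _) (Eventually.of_forall fun s => hmem n s)
  refine hM.isClosed.mem_of_tendsto (b := atTop) ?_ (Eventually.of_forall hmemn)
  refine Tendsto.prodMk_nhds ?_ (tendsto_const_nhds.sub (hVt t ht))
  refine intervalIntegral.tendsto_integral_filter_of_dominated_convergence
    (fun _ => ‖x‖ + ‖y‖) (Eventually.of_forall fun n =>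
      ((hcont n).sub ((hac n).const_smul (c n))).aestronglyMeasurable) ?_
      (by simp) ?_
  · refine Eventually.of_forall fun n => Eventually.of_forall fun s hs => ?_
    rw [Set.uIoc_of_le ht] at hs
    refine (norm_sub_le _ _).trans (add_le_add (hun n s hs.1.le) ?_)
    rw [norm_smul, Real.norm_of_nonneg (hc0 n).le]
    have h1 : c n ≤ 1 := by
      simp only [hc]
      rw [div_le_one (by positivity)]
      linarith [(Nat.cast_nonneg n : (0 : ℝ) ≤ n)]
    calc c n * ‖a n s‖ ≤ 1 * ‖y‖ := by
          gcongr
          exact ha n s hs.1.le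
      _ = ‖y‖ := one_mul _
  · refine Eventually.of_forall fun s hs => ?_
    rw [Set.uIoc_of_le ht] at hs
    have h1 : Tendsto (fun n => c n • a n s) atTop (𝓝 0) := by
      refine squeeze_zero_norm (a := fun n => c n * ‖y‖) (fun n => ?_)
        (by simpa using hclim.mul_const ‖y‖)
      rw [norm_smul, Real.norm_of_nonneg (hc0 n).le]
      exact mul_le_mul_of_nonneg_left (ha n s hs.1.le) (hc0 n).le
    simpa using (hVt s hs.1.le).sub h1

/-- By linearity and uniqueness the difference is the solution started at x - x', whose norm never
exceeds ‖x - x'‖. -/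
theorem homogeneous_sub_le (hM : IsMaximalMonotoneGraph M) {x y x' y' : X}
    (hxy : (x, y) ∈ M) (hxy' : (x', y') ∈ M) {U U' : ℝ → X} (hU : Continuous U)
    (hU' : Continuous U') (h : ∀ t, 0 ≤ t → (∫ s in (0 : ℝ)..t, U s, x - U t) ∈ M)
    (h' : ∀ t, 0 ≤ t → (∫ s in (0 : ℝ)..t, U' s, x' - U' t) ∈ M) {t : ℝ} (ht : 0 ≤ t) :
    ‖U t - U' t‖ ≤ ‖x - x'‖ := by
  obtain ⟨W, hWc, hWn, hW⟩ := hM.exists_homogeneous_of_mem (M.sub_mem hxy hxy')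
  have e1 : IsIntegralSolution M t (x - x') (fun _ => (0 : X) - 0) (fun t => U t - U' t) :=
    IsIntegralSolution.sub ⟨hU, fun s hs => by simpa using h s hs.1⟩
      ⟨hU', fun s hs => by simpa using h' s hs.1⟩ (by simp) (by simp)
  have e2 : IsIntegralSolution M t (x - x') (fun _ => (0 : X) - 0) W :=
    ⟨hWc, fun s hs => by simpa using hW s hs.1⟩
  rw [hM.integralSolution_unique e1 e2 ⟨ht, le_rfl⟩]
  exact hWn t

open Filter Topology in
-- The domain is dense and solutions depend on their data by contraction, so solutions for
-- approximating data converge uniformly in time.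
theorem exists_homogeneous (hM : IsMaximalMonotoneGraph M) (x : X) :
    ∃ U : ℝ → X, Continuous U ∧ (∀ t, ‖U t‖ ≤ ‖x‖) ∧
      ∀ t, 0 ≤ t → (∫ s in (0 : ℝ)..t, U s, x - U t) ∈ M := by
  obtain ⟨ξ, hξ, hξx⟩ := mem_closure_iff_seq_limit.mp (hM.dense_domain x)
  choose η hη using hξ
  choose U hUc hUn hU using fun n => hM.exists_homogeneous_of_mem (hη n)
  have hsub : ∀ m n t, 0 ≤ t → dist (U m t) (U n t) ≤ dist (ξ m) (ξ n) := by
    intro m n t ht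
    rw [dist_eq_norm, dist_eq_norm]
    exact hM.homogeneous_sub_le (hη m) (hη n) (hUc m) (hUc n) (hU m) (hU n) ht
  have hcau : ∀ t, 0 ≤ t → CauchySeq fun n => U n t := by
    intro t ht
    have h1 := hξx.cauchySeq
    rw [Metric.cauchySeq_iff] at h1 ⊢
    intro ε hε
    obtain ⟨N, hN⟩ := h1 ε hε
    exact ⟨N, fun m hm n hn => (hsub m n t ht).trans_lt (hN m hm n hn)⟩
  choose V hV using fun t : ℝ => cauchySeq_tendsto_of_complete (hcau (max t 0) (le_max_right _ _))
  have hVt : ∀ t, 0 ≤ t → Tendsto (fun n => U n t) atTop (𝓝 (V t)) := fun t ht => by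
    simpa [max_eq_left ht] using hV t
  have hunif : TendstoUniformly (fun n t => U n (max t 0)) V atTop := by
    refine UniformCauchySeqOn.tendstoUniformlyOn_of_tendsto (s := Set.univ) ?_
      (fun t _ => hV t) |> tendstoUniformlyOn_univ.mp
    rw [Metric.uniformCauchySeqOn_iff]
    intro ε hε
    obtain ⟨N, hN⟩ := Metric.cauchySeq_iff.mp hξx.cauchySeq ε hε
    exact ⟨N, fun m hm n hn t _ =>
      (hsub m n _ (le_max_right _ _)).trans_lt (hN m hm n hn)⟩
  have hVc : Continuous V := hunif.continuous
    (Frequently.of_forall fun n => (hUc n).comp (by fun_prop))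
  have hbd : ∃ b, ∀ n, ‖ξ n‖ ≤ b := by
    obtain ⟨b, hb⟩ := hξx.norm.bddAbove_range
    exact ⟨b, fun n => hb ⟨n, rfl⟩⟩
  obtain ⟨b, hb⟩ := hbd
  refine ⟨V, hVc, fun t => ?_, fun t ht => ?_⟩
  · exact le_of_tendsto_of_tendsto' (hV t).norm hξx.norm fun n => hUn n _
  refine hM.isClosed.mem_of_tendsto (b := atTop) ?_ (Eventually.of_forall fun n => hU n t ht)
  refine Tendsto.prodMk_nhds ?_ (hξx.sub (hVt t ht))
  refine intervalIntegral.tendsto_integral_filter_of_dominated_convergence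
    (fun _ => b) (Eventually.of_forall fun n => (hUc n).aestronglyMeasurable)
    (Eventually.of_forall fun n => Eventually.of_forall fun s _ => (hUn n s).trans (hb n))
    (by simp) ?_
  refine Eventually.of_forall fun s hs => ?_
  rw [Set.uIoc_of_le ht] at hs
  exact hVt s hs.1.le

/-- The contraction semigroup generated by `-L`, extended constantly to negative times. -/
theorem exists_semigroup (hM : IsMaximalMonotoneGraph M) :
    ∃ S : ℝ → X →L[ℝ] X, (∀ t x, ‖S t x‖ ≤ ‖x‖) ∧ (∀ x, Continuous fun t => S t x) ∧
      ∀ x t, 0 ≤ t → (∫ s in (0 : ℝ)..t, S s x, x - S t x) ∈ M := by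
  choose U hUc hUn hU using hM.exists_homogeneous
  have hsol : ∀ x T, IsIntegralSolution M T x (fun _ => 0) (U x) := fun x T =>
    ⟨hUc x, fun t ht => by simpa using hU x t ht.1⟩
  have hadd : ∀ x y t, 0 ≤ t → U (x + y) t = U x t + U y t := by
    intro x y t ht
    refine hM.integralSolution_unique (hsol (x + y) t) (U' := fun t => U x t + U y t)
      ⟨(hUc x).add (hUc y), fun s hs => ?_⟩ ⟨ht, le_rfl⟩
    have := M.add_mem (hU x s hs.1) (hU y s hs.1)
    rw [intervalIntegral.integral_add ((hUc x).intervalIntegrable _ _)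
      ((hUc y).intervalIntegrable _ _)]
    convert this using 1
    simp only [intervalIntegral.integral_zero, add_zero, Prod.mk_add_mk]
    congr 1
    abel
  have hsmul : ∀ (c : ℝ) x t, 0 ≤ t → U (c • x) t = c • U x t := by
    intro c x t ht
    refine hM.integralSolution_unique (hsol (c • x) t) (U' := fun t => c • U x t)
      ⟨(hUc x).const_smul c, fun s hs => ?_⟩ ⟨ht, le_rfl⟩
    have := M.smul_mem c (hU x s hs.1)
    rw [intervalIntegral.integral_smul]
    convert this using 1
    simp [smul_sub]
  let S : ℝ → X →L[ℝ] X := fun t => LinearMap.mkContinuous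
    { toFun := fun x => U x (max t 0)
      map_add' := fun x y => hadd x y _ (le_max_right _ _)
      map_smul' := fun c x => hsmul c x _ (le_max_right _ _) } 1
    (fun x => by rw [one_mul]; exact hUn x _)
  have hS : ∀ t x, S t x = U x (max t 0) := fun t x => rfl
  refine ⟨S, fun t x => hUn x _, fun x => (hUc x).comp (by fun_prop), fun x t ht => ?_⟩
  have h1 : ∫ s in (0 : ℝ)..t, S s x = ∫ s in (0 : ℝ)..t, U x s := by
    refine intervalIntegral.integral_congr fun s hs => ?_
    rw [Set.uIcc_of_le ht] at hs
    change U x (max s 0) = U x s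
    rw [max_eq_left hs.1]
  rw [h1, hS, max_eq_left ht]
  exact hU x t ht

end IsMaximalMonotoneGraph
end IntegralSolution

/-! ### Variation of constants for the inhomogeneous equation -/

section Duhamel

variable {X : Type*} [NormedAddCommGroup X] [InnerProductSpace ℝ X]

theorem integral_indicator_Iio {E : Type*} [NormedAddCommGroup E] [NormedSpace ℝ E] (g : ℝ → E)
    {t T : ℝ} (ht : t ∈ Set.Icc 0 T) :
    ∫ s in Set.Ioc 0 T, (Set.Iio t).indicator g s = ∫ s in (0 : ℝ)..t, g s := by
  rw [integral_indicator measurableSet_Iio, Measure.restrict_restrict measurableSet_Iio,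
    intervalIntegral.integral_of_le ht.1, integral_Ioc_eq_integral_Ioo]
  congr 2
  ext s
  simp only [Set.mem_inter_iff, Set.mem_Iio, Set.mem_Ioc, Set.mem_Ioo]
  exact ⟨fun h => ⟨h.2.1, h.1⟩, fun h => ⟨h.2, h.1, h.2.le.trans ht.2⟩⟩

open Filter Topology in
-- The uniform bound upgrades strong continuity to joint continuity. This makes s ↦ S(r - s) G(s)
-- measurable for a merely measurable source G.
theorem continuous_apply_of_norm_le {S : ℝ → X →L[ℝ] X} (hn : ∀ t x, ‖S t x‖ ≤ ‖x‖)
    (hc : ∀ x, Continuous fun t => S t x) : Continuous fun p : ℝ × X => S p.1 p.2 := by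
  refine continuous_iff_continuousAt.mpr fun q => ?_
  have h1 : Tendsto (fun p : ℝ × X => S p.1 (p.2 - q.2)) (𝓝 q) (𝓝 0) := by
    refine squeeze_zero_norm (fun p => hn p.1 _) ?_
    have : Continuous fun p : ℝ × X => ‖p.2 - q.2‖ := by fun_prop
    simpa using this.tendsto q
  have h2 : Tendsto (fun p : ℝ × X => S p.1 q.2) (𝓝 q) (𝓝 (S q.1 q.2)) :=
    ((hc q.2).comp continuous_fst).tendsto q
  have h3 := h1.add h2
  rw [zero_add] at h3
  refine h3.congr fun p => ?_
  rw [← map_add, sub_add_cancel]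

namespace IsMaximalMonotoneGraph

variable [CompleteSpace X] {M : Submodule ℝ (X × X)}

open Filter Topology in
/-- Variation of constants. -/
theorem exists_integralSolution (hM : IsMaximalMonotoneGraph M) {T : ℝ} (hT : 0 ≤ T) (x : X)
    {G : ℝ → X} (hG : IntervalIntegrable G volume 0 T) :
    ∃ U : ℝ → X, IsIntegralSolution M T x G U ∧
      ∀ t ∈ Set.Icc 0 T, ‖U t‖ ≤ ‖x‖ + ∫ s in (0 : ℝ)..t, ‖G s‖ := by
  obtain ⟨S, hSn, hSc, hS⟩ := hM.exists_semigroup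
  have hSj := continuous_apply_of_norm_le hSn hSc
  set μ : Measure ℝ := volume.restrict (Set.Ioc 0 T) with hμ
  have hGi : Integrable G μ := (intervalIntegrable_iff_integrableOn_Ioc_of_le hT).mp hG
  -- The Duhamel integrand is cut off at s = r, so that the domain of integration no longer depends
  -- on r. Dominated convergence and Fubini then apply directly.
  set F : ℝ → ℝ → X := fun r => (Set.Iio r).indicator fun s => S (r - s) (G s) with hF
  have hFn : ∀ r s, ‖F r s‖ ≤ ‖G s‖ := fun r s =>
    (norm_indicator_le_norm_self _ _).trans (hSn _ _)
  have hFm : ∀ r, AEStronglyMeasurable (F r) μ := by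
    intro r
    refine AEStronglyMeasurable.indicator ?_ measurableSet_Iio
    have h1 : AEStronglyMeasurable (fun s => (r - s, G s)) μ :=
      AEStronglyMeasurable.prodMk (by fun_prop) hGi.aestronglyMeasurable
    exact hSj.comp_aestronglyMeasurable h1
  have hFi : ∀ r, Integrable (F r) μ := fun r =>
    hGi.mono (hFm r) (Eventually.of_forall fun s => hFn r s)
  set P : ℝ → X := fun r => ∫ s, F r s ∂μ with hP
  have hPc : Continuous P := by
    refine continuous_iff_continuousAt.mpr fun r => ?_
    refine continuousAt_of_dominated (bound := fun s => ‖G s‖)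
      (Eventually.of_forall fun r => hFm r)
      (Eventually.of_forall fun r => Eventually.of_forall fun s => hFn r s) hGi.norm ?_
    have hne : ∀ᵐ s ∂μ, s ≠ r := ae_restrict_of_ae (Measure.ae_ne volume r)
    filter_upwards [hne] with s hs
    have hcS : Continuous fun r => S (r - s) (G s) := (hSc (G s)).comp (by fun_prop)
    rcases lt_or_gt_of_ne hs with h | h
    · refine hcS.continuousAt.congr ?_
      filter_upwards [lt_mem_nhds h] with r' hr'
      exact (Set.indicator_of_mem (s := Set.Iio r') hr' fun s => S (r' - s) (G s)).symm
    · refine (continuousAt_const (y := (0 : X))).congr ?_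
      filter_upwards [gt_mem_nhds h] with r' hr'
      exact (Set.indicator_of_notMem (s := Set.Iio r') (not_lt.mpr hr'.le)
        fun s => S (r' - s) (G s)).symm
  refine ⟨fun t => S t x + P t, ⟨(hSc x).add hPc, fun t ht => ?_⟩, fun t ht => ?_⟩
  -- For each s, the trajectory started at time s from G(s) satisfies the integrated equation.
  -- Integrating these memberships over s and swapping the two integrals gives the equation for the
  -- Duhamel term.
  · have hk : ∀ᵐ s ∂μ, (∫ r in (0 : ℝ)..t, F r s,
        (Set.Iio t).indicator (fun s => G s) s - F t s) ∈ M := by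
      filter_upwards [ae_restrict_mem measurableSet_Ioc] with s hs
      rcases lt_or_ge s t with hst | hst
      · have e1 : F t s = S (t - s) (G s) := Set.indicator_of_mem (s := Set.Iio t) hst _
        have e2 : (Set.Iio t).indicator (fun s => G s) s = G s :=
          Set.indicator_of_mem (s := Set.Iio t) hst _
        have e3 : ∫ r in (0 : ℝ)..t, F r s = ∫ r in (0 : ℝ)..(t - s), S r (G s) := by
          have e4 : ∀ r, F r s = (Set.Ioi s).indicator (fun r => S (r - s) (G s)) r := fun r => rfl
          have e5 : ∫ r in (0 : ℝ)..t, F r s = ∫ r in s..t, S (r - s) (G s) := by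
            simp_rw [e4]
            rw [intervalIntegral.integral_of_le ht.1, intervalIntegral.integral_of_le hst.le,
              integral_indicator measurableSet_Ioi, Measure.restrict_restrict measurableSet_Ioi]
            congr 2
            ext r
            simp only [Set.mem_inter_iff, Set.mem_Ioi, Set.mem_Ioc]
            exact ⟨fun h => ⟨h.1, h.2.2⟩, fun h => ⟨h.1, hs.1.trans h.1, h.2⟩⟩
          rw [e5, intervalIntegral.integral_comp_sub_right (fun r => S r (G s)) s, sub_self]
        rw [e1, e2, e3]
        exact hS _ _ (sub_nonneg.mpr hst.le)
      · have e1 : F t s = 0 := Set.indicator_of_notMem (s := Set.Iio t) (not_lt.mpr hst) _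
        have e2 : (Set.Iio t).indicator (fun s => G s) s = 0 :=
          Set.indicator_of_notMem (s := Set.Iio t) (not_lt.mpr hst) _
        have e3 : ∫ r in (0 : ℝ)..t, F r s = 0 := by
          rw [intervalIntegral.integral_of_le ht.1]
          refine integral_eq_zero_of_ae ?_
          filter_upwards [ae_restrict_mem measurableSet_Ioc] with r hr
          exact Set.indicator_of_notMem (s := Set.Iio r) (not_lt.mpr (hr.2.trans hst)) _
        rw [e1, e2, e3, sub_zero]
        exact M.zero_mem
    have hprod : Integrable (Function.uncurry F) ((volume.restrict (Set.Ioc 0 t)).prod μ) := by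
      have hd : Integrable (fun p : ℝ × ℝ => G p.2) ((volume.restrict (Set.Ioc 0 t)).prod μ) :=
        hGi.comp_snd _
      refine hd.mono ?_ (Eventually.of_forall fun p => hFn p.1 p.2)
      have e1 : Function.uncurry F = {p : ℝ × ℝ | p.2 < p.1}.indicator
          fun p => S (p.1 - p.2) (G p.2) := by
        ext p
        rfl
      rw [e1]
      refine AEStronglyMeasurable.indicator ?_ (measurableSet_lt measurable_snd measurable_fst)
      have h1 : AEStronglyMeasurable (fun p : ℝ × ℝ => (p.1 - p.2, G p.2))
          ((volume.restrict (Set.Ioc 0 t)).prod μ) :=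
        AEStronglyMeasurable.prodMk (by fun_prop) hd.aestronglyMeasurable
      exact hSj.comp_aestronglyMeasurable h1
    have hswap : ∫ r in (0 : ℝ)..t, P r = ∫ s, (∫ r in (0 : ℝ)..t, F r s) ∂μ := by
      simp only [intervalIntegral.integral_of_le ht.1, hP]
      exact integral_integral_swap hprod
    have hki : Integrable (fun s => ∫ r in (0 : ℝ)..t, F r s) μ := by
      simp only [intervalIntegral.integral_of_le ht.1]
      exact hprod.integral_prod_right
    have hGt : Integrable ((Set.Iio t).indicator fun s => G s) μ :=
      hGi.indicator measurableSet_Iio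
    have h1 := hM.integral_mem hki (hGt.sub (hFi t)) hk
    have h2 := M.add_mem (hS x t ht.1) h1
    have h3 : ∫ s, ((Set.Iio t).indicator (fun s => G s) - F t) s ∂μ
        = (∫ s in (0 : ℝ)..t, G s) - P t := by
      rw [integral_sub' hGt (hFi t), integral_indicator_Iio _ ht]
    rw [h3, ← hswap] at h2
    rw [intervalIntegral.integral_add ((hSc x).intervalIntegrable _ _)
      (hPc.intervalIntegrable _ _)]
    convert h2 using 1
    simp only [Prod.mk_add_mk]
    congr 1
    abel
  · refine (norm_add_le _ _).trans (add_le_add (hSn t x) ?_)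
    refine (norm_integral_le_integral_norm _).trans ?_
    rw [← integral_indicator_Iio _ ht]
    refine integral_mono (hFi t).norm (hGi.norm.indicator measurableSet_Iio) fun s => ?_
    by_cases hs : s ∈ Set.Iio t
    · rw [Set.indicator_of_mem hs]
      exact hFn t s
    · simp [hF, Set.indicator_of_notMem hs]

theorem norm_integralSolution_le (hM : IsMaximalMonotoneGraph M) {T : ℝ} {x : X}
    {G U : ℝ → X} (hG : IntervalIntegrable G volume 0 T) (hU : IsIntegralSolution M T x G U)
    {t : ℝ} (ht : t ∈ Set.Icc 0 T) : ‖U t‖ ≤ ‖x‖ + ∫ s in (0 : ℝ)..t, ‖G s‖ := by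
  obtain ⟨V, hV, hVn⟩ := hM.exists_integralSolution (ht.1.trans ht.2) x hG
  rw [hM.integralSolution_unique hU hV ht]
  exact hVn t ht

theorem norm_integralSolution_sub_le (hM : IsMaximalMonotoneGraph M) {T : ℝ} {x x' : X}
    {G G' U U' : ℝ → X} (hG : IntervalIntegrable G volume 0 T)
    (hG' : IntervalIntegrable G' volume 0 T)
    (hU : IsIntegralSolution M T x G U) (hU' : IsIntegralSolution M T x' G' U')
    {t : ℝ} (ht : t ∈ Set.Icc 0 T) :
    ‖U t - U' t‖ ≤ ‖x - x'‖ + ∫ s in (0 : ℝ)..t, ‖G s - G' s‖ :=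
  hM.norm_integralSolution_le (hG.sub hG') (hU.sub hU' hG hG') ht

/-- An integrable function satisfying the time-integrated equation almost everywhere agrees
almost everywhere with a continuous solution. -/
theorem exists_integralSolution_ae_eq (hM : IsMaximalMonotoneGraph M) {T : ℝ} (hT : 0 ≤ T)
    {x : X} {G U : ℝ → X} (hG : IntervalIntegrable G volume 0 T)
    (hU : IntervalIntegrable U volume 0 T)
    (h : ∀ᵐ t ∂(volume.restrict (Set.Ioc 0 T)),
      (∫ s in (0 : ℝ)..t, U s, x - U t + ∫ s in (0 : ℝ)..t, G s) ∈ M) :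
    ∃ V, IsIntegralSolution M T x G V ∧ ∀ᵐ t ∂(volume.restrict (Set.Ioc 0 T)), U t = V t := by
  obtain ⟨V, hV, -⟩ := hM.exists_integralSolution hT x hG
  refine ⟨V, hV, ?_⟩
  -- The difference U - V is only integrable, so `primitive_eq_zero` does not apply to it. Its
  -- primitive W is continuous and satisfies (W, -D) ∈ M a.e.
  set D : ℝ → X := (Set.Ioc 0 T).indicator fun t => U t - V t with hD
  have hDi : Integrable D := by
    rw [hD, integrable_indicator_iff measurableSet_Ioc]
    exact (intervalIntegrable_iff_integrableOn_Ioc_of_le hT).mp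
      (hU.sub (hV.continuous.intervalIntegrable _ _))
  have hDI : ∀ a b, IntervalIntegrable D volume a b := fun a b => hDi.intervalIntegrable
  set W : ℝ → X := fun t => ∫ s in (0 : ℝ)..t, D s with hW
  have hWc : Continuous W := intervalIntegral.continuous_primitive hDI 0
  have hDeq : ∀ t ∈ Set.Ioc 0 T, D t = U t - V t := fun t ht => Set.indicator_of_mem ht _
  have hWD : ∀ᵐ t ∂(volume.restrict (Set.Ioc 0 T)), (W t, -D t) ∈ M := by
    filter_upwards [h, ae_restrict_mem measurableSet_Ioc] with t ht htT
    have h1 := M.sub_mem ht (hV.mem t ⟨htT.1.le, htT.2⟩)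
    have hsub : Set.uIcc 0 t ⊆ Set.uIcc 0 T := by
      rw [Set.uIcc_of_le htT.1.le, Set.uIcc_of_le hT]
      exact Set.Icc_subset_Icc le_rfl htT.2
    have h2 : W t = (∫ s in (0 : ℝ)..t, U s) - ∫ s in (0 : ℝ)..t, V s := by
      rw [← intervalIntegral.integral_sub (hU.mono_set hsub)
        (hV.continuous.intervalIntegrable _ _)]
      simp only [hW]
      rw [intervalIntegral.integral_of_le htT.1.le, intervalIntegral.integral_of_le htT.1.le]
      exact setIntegral_congr_fun measurableSet_Ioc fun s hs =>
        hDeq s ⟨hs.1, hs.2.trans htT.2⟩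
    rw [h2, hDeq t htT]
    convert h1 using 1
    simp only [Prod.mk_sub_mk]
    congr 1
    abel
  -- One more integration gives the integrated homogeneous equation for W at every time. Hence W =
  -- 0, and then (0, -D) ∈ M forces D = 0 a.e.
  have hZ : ∀ t ∈ Set.Icc 0 T, (∫ s in (0 : ℝ)..t, W s, -W t) ∈ M := by
    intro t ht
    have h1 := hM.intervalIntegral_mem ht.1 (hWc.intervalIntegrable _ _) (hDI 0 t).neg
      (ae_restrict_of_ae_restrict_of_subset (Set.Ioc_subset_Ioc_right ht.2) hWD)
    simpa only [Pi.neg_apply, intervalIntegral.integral_neg] using h1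
  have hW0 : ∀ t ∈ Set.Icc 0 T, W t = 0 := by
    intro t ht
    have h1 := hZ t ht
    rw [hM.primitive_eq_zero hWc hZ ht] at h1
    simpa using hM.eq_zero _ h1
  filter_upwards [hWD, ae_restrict_mem measurableSet_Ioc] with t ht htT
  rw [hW0 t ⟨htT.1.le, htT.2⟩, hDeq t htT] at ht
  exact sub_eq_zero.mp (neg_eq_zero.mp (hM.eq_zero _ ht))

end IsMaximalMonotoneGraph
end Duhamel

/-! ### Lipschitz nonlinearities: global solvability and regularity in time -/

section SemilinearEvolution

variable {X : Type*} [NormedAddCommGroup X] [InnerProductSpace ℝ X]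

/-- Grönwall's inequality: e^{-Kr}(a + K∫₀ʳ φ) is nonincreasing on [0, T]. -/
theorem le_mul_exp_of_le_add_integral {φ : ℝ → ℝ} (hφ : Continuous φ) {a K T : ℝ}
    (hK : 0 ≤ K) (h : ∀ t ∈ Set.Icc 0 T, φ t ≤ a + K * ∫ s in (0 : ℝ)..t, φ s) {t : ℝ}
    (ht : t ∈ Set.Icc 0 T) : φ t ≤ a * Real.exp (K * t) := by
  have hd : ∀ t, HasDerivAt (fun r => Real.exp (-(K * r)) * (a + K * ∫ s in (0 : ℝ)..r, φ s))
      (Real.exp (-(K * t)) * (-K) * (a + K * ∫ s in (0 : ℝ)..t, φ s)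
        + Real.exp (-(K * t)) * (K * φ t)) t := by
    intro t
    have h1 : HasDerivAt (fun r => Real.exp (-(K * r))) (Real.exp (-(K * t)) * (-K)) t := by
      have := ((hasDerivAt_id t).const_mul K).neg.exp
      rwa [mul_one] at this
    exact h1.mul (((hφ.integral_hasStrictDerivAt 0 t).hasDerivAt.const_mul K).const_add a)
  have hanti : AntitoneOn (fun r => Real.exp (-(K * r)) * (a + K * ∫ s in (0 : ℝ)..r, φ s))
      (Set.Icc 0 T) := by
    refine antitoneOn_of_deriv_nonpos (convex_Icc 0 T)
      (fun t _ => (hd t).continuousAt.continuousWithinAt)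
      (fun t _ => (hd t).differentiableAt.differentiableWithinAt) fun t ht => ?_
    rw [interior_Icc] at ht
    rw [(hd t).deriv]
    have h1 := h t ⟨ht.1.le, ht.2.le⟩
    have h2 : 0 ≤ Real.exp (-(K * t)) * K := by positivity
    nlinarith [mul_le_mul_of_nonneg_left h1 h2]
  have h1 := hanti ⟨le_rfl, ht.1.trans ht.2⟩ ht ht.1
  simp only [mul_zero, neg_zero, Real.exp_zero, intervalIntegral.integral_same, add_zero,
    one_mul] at h1
  refine (h t ht).trans ?_
  rw [Real.exp_neg, inv_mul_eq_div, div_le_iff₀ (Real.exp_pos _)] at h1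
  exact h1

theorem integral_exp_mul_le {κ : ℝ} (hκ : 0 < κ) (t : ℝ) :
    ∫ s in (0 : ℝ)..t, Real.exp (κ * s) ≤ Real.exp (κ * t) / κ := by
  rw [intervalIntegral.integral_comp_mul_left (fun s => Real.exp s) hκ.ne', integral_exp,
    smul_eq_mul, inv_mul_eq_div, mul_zero, Real.exp_zero]
  gcongr
  linarith

namespace IsMaximalMonotoneGraph

variable [CompleteSpace X] {M : Submodule ℝ (X × X)}

open Filter Topology in
-- By uniqueness, solutions with different horizons agree where both are defined, so the value at t
-- may be taken from the solution with horizon t. Near t they all agree with the solution of horizon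
-- t + 1 (or 0), which gives continuity. Negative times are frozen.
theorem exists_integralSolution_forall (hM : IsMaximalMonotoneGraph M) (x : X) {G : ℝ → X}
    (hG : ∀ T, 0 ≤ T → IntervalIntegrable G volume 0 T) :
    ∃ U : ℝ → X, (∀ t, U (max t 0) = U t) ∧ ∀ T, 0 ≤ T → IsIntegralSolution M T x G U := by
  choose V hV _ using fun T : {T : ℝ // 0 ≤ T} =>
    hM.exists_integralSolution T.2 x (hG T.1 T.2)
  set U : ℝ → X := fun t => V ⟨max t 0, le_max_right _ _⟩ (max t 0) with hU
  have hUV : ∀ T (hT : 0 ≤ T) t, t ≤ T → U t = V ⟨T, hT⟩ (max t 0) := by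
    intro T hT t ht
    refine hM.integralSolution_unique (T := max t 0) (hV ⟨max t 0, le_max_right _ _⟩)
      ((hV ⟨T, hT⟩).mono (max_le ht hT)) ⟨le_max_right _ _, le_rfl⟩
  refine ⟨U, fun t => by simp [hU], fun T hT => ⟨?_, fun t ht => ?_⟩⟩
  · refine continuous_iff_continuousAt.mpr fun t => ?_
    have h0 : 0 ≤ max (t + 1) 0 := le_max_right _ _
    have h1 : Continuous fun r => V ⟨_, h0⟩ (max r 0) :=
      (hV ⟨_, h0⟩).continuous.comp (by fun_prop)
    refine h1.continuousAt.congr ?_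
    filter_upwards [gt_mem_nhds (lt_add_one t)] with r hr
    exact (hUV _ h0 r (hr.le.trans (le_max_left _ _))).symm
  · have h1 : ∀ s, 0 ≤ s → s ≤ T → U s = V ⟨T, hT⟩ s := fun s hs hsT => by
      rw [hUV T hT s hsT, max_eq_left hs]
    have h2 : ∫ s in (0 : ℝ)..t, U s = ∫ s in (0 : ℝ)..t, V ⟨T, hT⟩ s := by
      refine intervalIntegral.integral_congr fun s hs => ?_
      rw [Set.uIcc_of_le ht.1] at hs
      exact h1 s hs.1 (hs.2.trans ht.2)
    rw [h1 t ht.1 ht.2, h2]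
    exact (hV ⟨T, hT⟩).mem t ht

open BoundedContinuousFunction NNReal in
/-- Global solvability of `U' + L U = Φ(U)`, `U 0 = x` for a Lipschitz map `Φ`. -/
theorem exists_semilinear (hM : IsMaximalMonotoneGraph M) {Φ : X → X} {ω : ℝ≥0}
    (hΦ : LipschitzWith ω Φ) (x : X) :
    ∃ U : ℝ → X, ∀ T, 0 ≤ T → IsIntegralSolution M T x (fun t => Φ (U t)) U := by
  -- The unknown is W = e^{-κt} U in the space of bounded continuous functions. In this weighted
  -- norm the solution map has Lipschitz constant at most ω/κ ≤ 1/2.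
  set κ : ℝ := 2 * ω + 1 with hκ
  have hκ0 : 0 < κ := by positivity
  set G : (ℝ →ᵇ X) → ℝ → X := fun W t => Φ (Real.exp (κ * t) • W t) with hG
  have hGc : ∀ W, Continuous (G W) := fun W =>
    hΦ.continuous.comp ((by fun_prop : Continuous fun t : ℝ => Real.exp (κ * t)).smul
      W.continuous)
  have hGi : ∀ W a b, IntervalIntegrable (G W) volume a b := fun W a b =>
    (hGc W).intervalIntegrable _ _
  choose V hVm hV using fun W => hM.exists_integralSolution_forall x fun T _ => hGi W 0 T
  have hVc : ∀ W, Continuous (V W) := fun W => (hV W 0 le_rfl).continuous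
  have hVsub : ∀ W W' t, 0 ≤ t →
      Real.exp (-(κ * t)) * ‖V W t - V W' t‖ ≤ 1 / 2 * dist W W' := by
    intro W W' t ht
    have h1 := hM.norm_integralSolution_sub_le (hGi W 0 t) (hGi W' 0 t) (hV W t ht) (hV W' t ht)
      ⟨ht, le_rfl⟩
    rw [sub_self, norm_zero, zero_add] at h1
    have h2 : ∫ s in (0 : ℝ)..t, ‖G W s - G W' s‖ ≤
        ∫ s in (0 : ℝ)..t, (ω * dist W W') * Real.exp (κ * s) := by
      refine intervalIntegral.integral_mono_on ht
        (((hGc W).sub (hGc W')).norm.intervalIntegrable _ _)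
        ((by fun_prop : Continuous fun s => (ω * dist W W') * Real.exp (κ * s)).intervalIntegrable
          _ _) fun s _ => ?_
      refine (hΦ.norm_sub_le _ _).trans ?_
      rw [← smul_sub, norm_smul, Real.norm_of_nonneg (Real.exp_pos _).le, mul_assoc,
        mul_comm (dist W W')]
      gcongr
      rw [← dist_eq_norm]
      exact dist_coe_le_dist s
    rw [intervalIntegral.integral_const_mul] at h2
    have h3 := mul_le_mul_of_nonneg_left (integral_exp_mul_le hκ0 t)
      (show (0 : ℝ) ≤ ω * dist W W' by positivity)
    rw [Real.exp_neg, inv_mul_eq_div, div_le_iff₀ (Real.exp_pos _)]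
    refine h1.trans (h2.trans (h3.trans ?_))
    rw [show (ω : ℝ) * dist W W' * (Real.exp (κ * t) / κ)
      = (ω / κ) * (dist W W' * Real.exp (κ * t)) by ring, mul_assoc]
    refine mul_le_mul_of_nonneg_right ?_ (by positivity)
    rw [div_le_iff₀ hκ0, hκ]
    linarith
  -- The image of W = 0 has finite weighted norm; with the contraction estimate, every image is
  -- bounded.
  obtain ⟨b, hb⟩ : ∃ b, ∀ t, 0 ≤ t → Real.exp (-(κ * t)) * ‖V 0 t‖ ≤ b := by
    refine ⟨‖x‖ + ‖Φ 0‖ / κ, fun t ht => ?_⟩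
    have h1 := hM.norm_integralSolution_le (hGi 0 0 t) (hV 0 t ht) ⟨ht, le_rfl⟩
    have h2 : ∫ s in (0 : ℝ)..t, ‖G 0 s‖ ≤ ∫ s in (0 : ℝ)..t, ‖Φ 0‖ * Real.exp (κ * s) := by
      refine intervalIntegral.integral_mono_on ht ((hGc 0).norm.intervalIntegrable _ _)
        ((by fun_prop : Continuous fun s => ‖Φ 0‖ * Real.exp (κ * s)).intervalIntegrable
          _ _) fun s hs => ?_
      have : 1 ≤ Real.exp (κ * s) := Real.one_le_exp (mul_nonneg hκ0.le hs.1)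
      simpa [hG] using le_mul_of_one_le_right (norm_nonneg (Φ 0)) this
    rw [intervalIntegral.integral_const_mul] at h2
    have h3 := mul_le_mul_of_nonneg_left (integral_exp_mul_le hκ0 t) (norm_nonneg (Φ 0))
    rw [Real.exp_neg, inv_mul_eq_div, div_le_iff₀ (Real.exp_pos _), add_mul]
    have h4 : ‖x‖ ≤ ‖x‖ * Real.exp (κ * t) :=
      le_mul_of_one_le_right (norm_nonneg _) (Real.one_le_exp (mul_nonneg hκ0.le ht))
    have h5 : ‖Φ 0‖ * (Real.exp (κ * t) / κ) = ‖Φ 0‖ / κ * Real.exp (κ * t) := by ring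
    linarith
  have hN : ∀ (t : ℝ) (z : X), ‖Real.exp (-(κ * t)) • z‖ = Real.exp (-(κ * t)) * ‖z‖ :=
    fun t z => by rw [norm_smul, Real.norm_of_nonneg (Real.exp_pos _).le]
  have hbd : ∀ W, ∀ t, ‖Real.exp (-(κ * max t 0)) • V W t‖ ≤ 1 / 2 * dist W 0 + b := by
    intro W t
    rw [← hVm W t, hN]
    refine le_trans ?_ (add_le_add (hVsub W 0 _ (le_max_right t 0)) (hb _ (le_max_right t 0)))
    rw [← mul_add]
    refine mul_le_mul_of_nonneg_left ?_ (Real.exp_pos _).le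
    exact norm_le_norm_sub_add _ _
  let Ψ : (ℝ →ᵇ X) → (ℝ →ᵇ X) := fun W => BoundedContinuousFunction.ofNormedAddCommGroup
    (fun t => Real.exp (-(κ * max t 0)) • V W t)
    ((by fun_prop : Continuous fun t : ℝ => Real.exp (-(κ * max t 0))).smul (hVc W)) _ (hbd W)
  have hΨ : ∀ W t, Ψ W t = Real.exp (-(κ * max t 0)) • V W t := fun W t => rfl
  have hcontr : ContractingWith (1 / 2 : ℝ≥0) Ψ := by
    refine ⟨by rw [← NNReal.coe_lt_coe]; norm_num, LipschitzWith.of_dist_le_mul fun W W' => ?_⟩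
    rw [BoundedContinuousFunction.dist_le (by positivity)]
    intro t
    rw [dist_eq_norm, hΨ, hΨ, ← smul_sub, ← hVm W t, ← hVm W' t, hN]
    simpa using hVsub W W' _ (le_max_right t 0)
  set W := ContractingWith.fixedPoint Ψ hcontr with hW
  have hfix : Ψ W = W := hcontr.fixedPoint_isFixedPt
  refine ⟨V W, fun T hT => (hV W T hT).congr_source ?_⟩
  filter_upwards [ae_restrict_mem measurableSet_Ioc] with t ht
  have h1 : W t = Real.exp (-(κ * t)) • V W t := by
    have := hΨ W t
    rwa [hfix, max_eq_left ht.1.le] at this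
  simp only [hG]
  rw [h1, smul_smul, ← Real.exp_add, add_neg_cancel, Real.exp_zero, one_smul]

/-- Solutions starting in the domain of the generator are Lipschitz in time. -/
theorem exists_lipschitzOnWith_of_mem (hM : IsMaximalMonotoneGraph M) {Φ : X → X} {ω : NNReal}
    (hΦ : LipschitzWith ω Φ) {x y : X} (hxy : (x, y) ∈ M) {U : ℝ → X}
    (hU : ∀ T, 0 ≤ T → IsIntegralSolution M T x (fun t => Φ (U t)) U) (T : ℝ) :
    ∃ C : NNReal, LipschitzOnWith C U (Set.Icc 0 T) := by
  have hUc : Continuous U := (hU 0 le_rfl).continuous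
  have hGc : Continuous fun t => Φ (U t) := hΦ.continuous.comp hUc
  obtain ⟨b, hb⟩ := isCompact_Icc.exists_bound_of_continuousOn (s := Set.Icc (0 : ℝ) T)
    (f := fun t => Φ (U t) - y) (hGc.sub continuous_const).continuousOn
  -- Since Lx = y, the constant curve x solves the equation with constant source y. Comparing U with
  -- it bounds the first increment.
  have hstart : ∀ h ∈ Set.Icc 0 T, ‖U h - x‖ ≤ b * h := by
    intro h hh
    have h1 : IsIntegralSolution M h x (fun _ => y) (fun _ => x) := by
      refine ⟨continuous_const, fun t _ => ?_⟩
      have := M.smul_mem t hxy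
      simpa using this
    have h2 := hM.norm_integralSolution_sub_le (hGc.intervalIntegrable 0 h)
      (continuous_const.intervalIntegrable _ _) (hU h hh.1) h1 ⟨hh.1, le_rfl⟩
    rw [sub_self, norm_zero, zero_add] at h2
    refine h2.trans ?_
    have h3 := intervalIntegral.integral_mono_on hh.1
      ((hGc.sub (continuous_const (y := y))).norm.intervalIntegrable 0 h)
      ((continuous_const (y := b)).intervalIntegrable (μ := volume) 0 h)
      fun s hs => hb s ⟨hs.1, hs.2.trans hh.2⟩
    simpa [mul_comm] using h3
  -- The translate r ↦ U(r + h) solves the same equation from U(h), which is within b·h of x.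
  -- Grönwall propagates this distance to time s, with factor e^{ωs} ≤ e^{ωT}.
  have hmain : ∀ s t, 0 ≤ s → s ≤ t → t ≤ T →
      ‖U t - U s‖ ≤ b * Real.exp (ω * T) * (t - s) := by
    intro s t hs hst htT
    set h := t - s with hh
    have hh0 : 0 ≤ h := sub_nonneg.mpr hst
    have hshift : Continuous fun r => U (r + h) := hUc.comp (by fun_prop)
    have hGshift : Continuous fun r => Φ (U (r + h)) := hΦ.continuous.comp hshift
    have hV : IsIntegralSolution M s (U h) (fun r => Φ (U (r + h))) (fun r => U (r + h)) := by
      refine ⟨hshift, fun r hr => ?_⟩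
      have h1 := M.sub_mem ((hU t (hs.trans hst)).mem (r + h)
        ⟨add_nonneg hr.1 hh0, by rw [hh]; linarith [hr.2]⟩) ((hU h hh0).mem h ⟨hh0, le_rfl⟩)
      rw [intervalIntegral.integral_comp_add_right (fun r => U r),
        intervalIntegral.integral_comp_add_right (fun r => Φ (U r)), zero_add,
        ← intervalIntegral.integral_interval_sub_left (hUc.intervalIntegrable 0 _)
          (hUc.intervalIntegrable 0 _),
        ← intervalIntegral.integral_interval_sub_left (hGc.intervalIntegrable 0 _)
          (hGc.intervalIntegrable 0 _)]
      convert h1 using 1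
      simp only [Prod.mk_sub_mk]
      congr 1
      abel
    have hgr : ∀ r ∈ Set.Icc 0 s, ‖U (r + h) - U r‖ ≤
        b * h + ω * ∫ q in (0 : ℝ)..r, ‖U (q + h) - U q‖ := by
      intro r hr
      refine (hM.norm_integralSolution_sub_le (hGshift.intervalIntegrable 0 s)
        (hGc.intervalIntegrable 0 s) hV (hU s hs) hr).trans (add_le_add ?_ ?_)
      · exact hstart h ⟨hh0, by rw [hh]; linarith⟩
      · rw [← intervalIntegral.integral_const_mul]
        exact intervalIntegral.integral_mono_on hr.1
          ((hGshift.sub hGc).norm.intervalIntegrable _ _)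
          ((continuous_const.mul (hshift.sub hUc).norm).intervalIntegrable _ _)
          fun q _ => hΦ.norm_sub_le _ _
    have h2 := le_mul_exp_of_le_add_integral (hshift.sub hUc).norm ω.coe_nonneg hgr
      ⟨hs, le_rfl⟩
    have h3 : s + h = t := by rw [hh]; ring
    change ‖U (s + h) - U s‖ ≤ _ at h2
    rw [h3] at h2
    refine h2.trans ?_
    have hb0 : 0 ≤ b := (norm_nonneg _).trans (hb t ⟨hs.trans hst, htT⟩)
    rw [mul_right_comm]
    gcongr
    exact hst.trans htT
  refine ⟨(b * Real.exp (ω * T)).toNNReal, LipschitzOnWith.of_dist_le_mul fun s hs t ht => ?_⟩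
  refine le_trans ?_ (mul_le_mul_of_nonneg_right (Real.le_coe_toNNReal _) dist_nonneg)
  rcases le_total s t with h | h
  · rw [dist_comm s t, dist_comm, dist_eq_norm, Real.dist_eq, abs_of_nonneg (sub_nonneg.mpr h)]
    exact hmain s t hs.1 h ht.2
  · rw [dist_eq_norm, Real.dist_eq, abs_of_nonneg (sub_nonneg.mpr h)]
    exact hmain t s ht.1 h hs.2

end IsMaximalMonotoneGraph
end SemilinearEvolution

/-! ### Lipschitz curves in Hilbert space and pointwise membership in the graph -/

section LipschitzCurves

variable {X : Type*} [NormedAddCommGroup X] [InnerProductSpace ℝ X] [CompleteSpace X]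

open Filter Topology

/-- Bounded families in a Hilbert space converge weakly along ultrafilters. -/
theorem exists_weak_limit {ι : Type*} (l : Ultrafilter ι) {y : ι → X} {C : ℝ}
    (hy : ∀ᶠ i in (l : Filter ι), ‖y i‖ ≤ C) :
    ∃ z : X, ∀ w : X, Tendsto (fun i => inner ℝ (y i) w) l (𝓝 (inner ℝ z w)) := by
  set φ : ι → WeakDual ℝ X := fun i => StrongDual.toWeakDual (InnerProductSpace.toDual ℝ X (y i))
    with hφ
  obtain ⟨ψ, -, hψ⟩ := (WeakDual.isCompact_closedBall (𝕜 := ℝ) (E := X) 0 C).ultrafilter_le_nhds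
    (l.map φ) (by
      rw [le_principal_iff]
      change ∀ᶠ i in (l : Filter ι), φ i ∈ _
      filter_upwards [hy] with i hi
      rw [Set.mem_preimage, mem_closedBall_zero_iff]
      change ‖InnerProductSpace.toDual ℝ X (y i)‖ ≤ C
      rwa [LinearIsometryEquiv.norm_map])
  refine ⟨(InnerProductSpace.toDual ℝ X).symm (WeakDual.toStrongDual ψ), fun w => ?_⟩
  rw [InnerProductSpace.toDual_symm_apply]
  exact ((WeakDual.eval_continuous (𝕜 := ℝ) w).tendsto ψ).comp hψ

theorem tendsto_average_of_continuous {u : ℝ → X} (hu : Continuous u) (t : ℝ) :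
    Tendsto (fun h : ℝ => h⁻¹ • ∫ s in t..t + h, u s) (𝓝[>] 0) (𝓝 (u t)) := by
  refine ((hu.integral_hasStrictDerivAt 0 t).hasDerivAt.tendsto_slope_zero_right).congr fun h => ?_
  rw [intervalIntegral.integral_interval_sub_left (hu.intervalIntegrable _ _)
    (hu.intervalIntegrable _ _)]

/-- A Lipschitz curve in a Hilbert space is the primitive of an integrable function. -/
theorem exists_eq_integral_of_lipschitzWith {w : ℝ → X} {C : NNReal} (hw : LipschitzWith C w)
    (T : ℝ) : ∃ g : ℝ → X, IntegrableOn g (Set.Ioc 0 T) ∧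
      ∀ t ∈ Set.Icc 0 T, w t = w 0 + ∫ s in (0 : ℝ)..t, g s := by
  set μ : Measure ℝ := volume.restrict (Set.Ioc 0 T) with hμ
  have hwc := hw.continuous
  -- The derivative is found as a weak limit in L²(0, T; X) of the difference quotients, which are
  -- bounded by C.
  set q : ℝ → ℝ → X := fun h t => h⁻¹ • (w (t + h) - w t) with hq
  have hqc : ∀ h, Continuous (q h) := fun h =>
    ((hwc.comp (by fun_prop)).sub hwc).const_smul h⁻¹
  have hqn : ∀ h t, ‖q h t‖ ≤ C := by
    intro h t
    rcases eq_or_ne h 0 with rfl | hh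
    · simp [hq]
    · simp only [hq]
      rw [norm_smul, norm_inv, inv_mul_le_iff₀ (norm_pos_iff.mpr hh)]
      have := hw.norm_sub_le (t + h) t
      rwa [add_sub_cancel_left, mul_comm] at this
  have hqL : ∀ h, MemLp (q h) 2 μ := fun h =>
    MemLp.of_bound (hqc h).aestronglyMeasurable C (Eventually.of_forall (hqn h))
  -- A fixed ultrafilter finer than h → 0⁺ gives weak convergence without extracting subsequences or
  -- assuming separability.
  set l : Ultrafilter ℝ := Ultrafilter.of (𝓝[>] (0 : ℝ)) with hl
  have hlle : (l : Filter ℝ) ≤ 𝓝[>] 0 := Ultrafilter.of_le _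
  obtain ⟨g, hg⟩ := exists_weak_limit (X := Lp X 2 μ) l
    (y := fun h => (hqL h).toLp (q h)) (Eventually.of_forall fun h =>
      Lp.norm_le_of_ae_bound C.coe_nonneg (by
        filter_upwards [(hqL h).coeFn_toLp] with t ht
        rw [ht]
        exact hqn h t))
  have hgi : Integrable g μ :=
    (Lp.memLp g).integrable (by norm_num)
  refine ⟨g, hgi, fun t ht => ?_⟩
  -- The integral of a difference quotient telescopes to the average of w over [t, t + h] minus its
  -- average over [0, h].
  have hlim : Tendsto (fun h => ∫ s in (0 : ℝ)..t, q h s) l (𝓝 (w t - w 0)) := by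
    refine (((tendsto_average_of_continuous hwc t).sub
      (tendsto_average_of_continuous hwc 0)).mono_left hlle).congr fun h => ?_
    simp only [hq]
    have hi : ∀ a b, IntervalIntegrable w volume a b := fun a b => hwc.intervalIntegrable a b
    rw [intervalIntegral.integral_smul, intervalIntegral.integral_sub
      ((by fun_prop : Continuous fun s => w (s + h)).intervalIntegrable _ _) (hi _ _),
      intervalIntegral.integral_comp_add_right, ← smul_sub]
    congr 1
    rw [← intervalIntegral.integral_interval_sub_left (hi 0 (t + h)) (hi 0 t),
      ← intervalIntegral.integral_interval_sub_left (hi 0 (t + h)) (hi 0 (0 + h))]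
    abel
  have hset : ∀ u : ℝ → X, ∫ s in Set.Iic t, u s ∂μ = ∫ s in (0 : ℝ)..t, u s := by
    intro u
    rw [hμ, Measure.restrict_restrict measurableSet_Iic, intervalIntegral.integral_of_le ht.1]
    congr 2
    ext s
    simp only [Set.mem_inter_iff, Set.mem_Iic, Set.mem_Ioc]
    exact ⟨fun h => ⟨h.2.1, h.1⟩, fun h => ⟨h.2, h.1, h.2.trans ht.2⟩⟩
  rw [← sub_eq_iff_eq_add']
  refine ext_inner_left ℝ fun c => ?_
  -- Testing the weak limit against the vector c on (-∞, t] extracts ⟨c, ∫₀ᵗ g⟩.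
  have h1 := hg (indicatorConstLp 2 measurableSet_Iic (measure_ne_top μ (Set.Iic t)) c)
  simp only [real_inner_comm (indicatorConstLp 2 measurableSet_Iic
    (measure_ne_top μ (Set.Iic t)) c)] at h1
  simp only [L2.inner_indicatorConstLp_eq_inner_setIntegral] at h1
  rw [hset] at h1
  have h2 : ∀ h, ∫ s in Set.Iic t, (hqL h).toLp (q h) s ∂μ = ∫ s in (0 : ℝ)..t, q h s := by
    intro h
    rw [← hset]
    exact integral_congr_ae (ae_restrict_of_ae (hqL h).coeFn_toLp)
  simp only [h2] at h1
  exact tendsto_nhds_unique (tendsto_const_nhds.inner hlim) h1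

/-- A Lipschitz curve in a Hilbert space is almost everywhere differentiable, with bounded
derivative, and it is the primitive of its derivative. -/
theorem LipschitzOnWith.ae_hasDerivAt_and_eq_integral {w : ℝ → X} {C : NNReal} {T : ℝ}
    (hT : 0 ≤ T) (hw : LipschitzOnWith C w (Set.Icc 0 T)) :
    MemLp (deriv w) ⊤ (volume.restrict (Set.Ioo 0 T)) ∧
      (∀ᵐ t ∂(volume.restrict (Set.Ioo 0 T)), HasDerivAt w (deriv w t) t) ∧
      ∀ t ∈ Set.Icc 0 T, w t = w 0 + ∫ s in (0 : ℝ)..t, deriv w s := by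
  -- Constant extension beyond [0, T] keeps the Lipschitz constant and makes difference quotients
  -- available up to the endpoint.
  set v : ℝ → X := fun t => w (Set.projIcc 0 T hT t) with hv
  have hvw : ∀ t ∈ Set.Icc 0 T, v t = w t := fun t ht => by
    simp only [hv]
    rw [Set.projIcc_of_mem hT ht]
  have hvl : LipschitzWith C v := by
    refine LipschitzWith.of_dist_le_mul fun s t => ?_
    refine (hw.dist_le_mul _ (Subtype.coe_prop _) _ (Subtype.coe_prop _)).trans ?_
    refine mul_le_mul_of_nonneg_left ?_ C.coe_nonneg
    have h1 := (LipschitzWith.projIcc hT).dist_le_mul s t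
    rwa [NNReal.coe_one, one_mul] at h1
  obtain ⟨g, hgi, hg⟩ := exists_eq_integral_of_lipschitzWith hvl T
  have hwg : ∀ t ∈ Set.Icc 0 T, w t = w 0 + ∫ s in (0 : ℝ)..t, g s := fun t ht => by
    rw [← hvw t ht, ← hvw 0 ⟨le_rfl, hT⟩]
    exact hg t ht
  have hgI : IntervalIntegrable g volume 0 T :=
    (intervalIntegrable_iff_integrableOn_Ioc_of_le hT).mpr hgi
  have hd : ∀ᵐ t ∂(volume.restrict (Set.Ioo 0 T)), HasDerivAt w (g t) t := by
    filter_upwards [ae_restrict_of_ae hgI.ae_hasDerivAt_integral,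
      ae_restrict_mem measurableSet_Ioo] with t ht htT
    rw [Set.uIcc_of_le hT] at ht
    have h1 := (ht ⟨htT.1.le, htT.2.le⟩ 0 ⟨le_rfl, hT⟩).const_add (w 0)
    refine h1.congr_of_eventuallyEq ?_
    filter_upwards [Ioo_mem_nhds htT.1 htT.2] with s hs
    exact hwg s ⟨hs.1.le, hs.2.le⟩
  have hdg : ∀ᵐ t ∂(volume.restrict (Set.Ioo 0 T)), g t = deriv w t := by
    filter_upwards [hd] with t ht using ht.deriv.symm
  have hgm : AEStronglyMeasurable g (volume.restrict (Set.Ioo 0 T)) :=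
    (hgi.mono_set Set.Ioo_subset_Ioc_self).aestronglyMeasurable
  refine ⟨memLp_top_of_bound (hgm.congr hdg) C ?_, ?_, fun t ht => ?_⟩
  · filter_upwards [ae_restrict_mem measurableSet_Ioo] with t ht
    exact norm_deriv_le_of_lipschitzOn (Icc_mem_nhds ht.1 ht.2) hw
  · filter_upwards [hd] with t ht
    rwa [ht.deriv]
  · rw [hwg t ht, intervalIntegral.integral_of_le ht.1, intervalIntegral.integral_of_le ht.1,
      integral_Ioc_eq_integral_Ioo, integral_Ioc_eq_integral_Ioo]
    congr 1
    exact integral_congr_ae (ae_restrict_of_ae_restrict_of_subset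
      (Set.Ioo_subset_Ioo_right ht.2) hdg)

namespace IsMaximalMonotoneGraph

variable {M : Submodule ℝ (X × X)}

/-- The graph is closed for strong convergence of x and weak convergence of y: in J(x + y) = x the
adjoint moves J onto the test vector. Boundedness of y yields a weak limit. -/
theorem exists_mem_of_tendsto_of_bounded (hM : IsMaximalMonotoneGraph M) {ι : Type*}
    {l : Filter ι} [l.NeBot] {x y : ι → X} {x₀ : X} {C : ℝ} (h : ∀ᶠ i in l, (x i, y i) ∈ M)
    (hx : Tendsto x l (𝓝 x₀)) (hy : ∀ᶠ i in l, ‖y i‖ ≤ C) : ∃ y₀, (x₀, y₀) ∈ M := by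
  obtain ⟨J, hJ⟩ := hM.exists_resolvent_one
  have hle : (Ultrafilter.of l : Filter ι) ≤ l := Ultrafilter.of_le l
  obtain ⟨y₀, hy₀⟩ := exists_weak_limit (Ultrafilter.of l) (hle hy)
  refine ⟨y₀, (hJ _ _).mpr (ext_inner_right ℝ fun z => ?_)⟩
  have hx' := hx.mono_left hle
  have h1 : Tendsto (fun i => inner ℝ (J (x i + y i)) z) (Ultrafilter.of l)
      (𝓝 (inner ℝ (J (x₀ + y₀)) z)) := by
    simp only [← ContinuousLinearMap.adjoint_inner_right J, inner_add_left]
    exact (hx'.inner tendsto_const_nhds).add (hy₀ _)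
  have h2 : Tendsto (fun i => inner ℝ (J (x i + y i)) z) (Ultrafilter.of l)
      (𝓝 (inner ℝ x₀ z)) := by
    refine (hx'.inner tendsto_const_nhds).congr' ?_
    filter_upwards [hle h] with i hi
    rw [(hJ _ _).mp hi]
  exact tendsto_nhds_unique h1 h2

end IsMaximalMonotoneGraph

namespace IsIntegralSolution

variable {M : Submodule ℝ (X × X)} {T : ℝ} {x : X} {G U : ℝ → X}

/-- At a point of differentiability the averages of U and of G and the difference quotients of U all
converge strongly, so closedness of the graph gives the equation pointwise. -/
theorem mem_of_hasDerivAt (hM : IsMaximalMonotoneGraph M) (hU : IsIntegralSolution M T x G U)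
    (hG : Continuous G) {t : ℝ} (ht : t ∈ Set.Ioo 0 T) {d : X} (hd : HasDerivAt U d t) :
    (U t, G t - d) ∈ M := by
  refine hM.isClosed.mem_of_tendsto (b := 𝓝[>] (0 : ℝ))
    ((tendsto_average_of_continuous hU.continuous t).prodMk_nhds
      ((tendsto_average_of_continuous hG t).sub hd.tendsto_slope_zero_right)) ?_
  filter_upwards [Ioo_mem_nhdsGT (sub_pos.mpr ht.2)] with h hh
  exact hU.average_mem hG ht.1.le hh.1 (by linarith [hh.2])

/-- The difference quotients need not converge, but they are bounded, so weak closedness still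
places U t in the domain. This holds at every t in [0, T), not just almost every t. -/
theorem exists_mem_of_lipschitzOnWith (hM : IsMaximalMonotoneGraph M)
    (hU : IsIntegralSolution M T x G U) (hG : Continuous G) {C : NNReal}
    (hC : LipschitzOnWith C U (Set.Icc 0 T)) {t : ℝ} (ht : 0 ≤ t) (htT : t < T) :
    ∃ y, (U t, y) ∈ M := by
  refine hM.exists_mem_of_tendsto_of_bounded (l := 𝓝[>] (0 : ℝ)) (C := (‖G t‖ + 1) + C)
    ?_ (tendsto_average_of_continuous hU.continuous t)
    (y := fun h => h⁻¹ • (∫ s in t..t + h, G s) - h⁻¹ • (U (t + h) - U t)) ?_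
  · filter_upwards [Ioo_mem_nhdsGT (sub_pos.mpr htT)] with h hh
    exact hU.average_mem hG ht hh.1 (by linarith [hh.2])
  · filter_upwards [Ioo_mem_nhdsGT (sub_pos.mpr htT),
      (tendsto_average_of_continuous hG t).norm.eventually (gt_mem_nhds (lt_add_one _))]
      with h hh hGh
    refine (norm_sub_le _ _).trans (add_le_add hGh.le ?_)
    have h1 := hC.norm_sub_le (x := t + h) ⟨add_nonneg ht hh.1.le, by linarith [hh.2]⟩
      (y := t) ⟨ht, htT.le⟩
    rw [norm_smul, norm_inv, inv_mul_le_iff₀ (norm_pos_iff.mpr hh.1.ne')]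
    rwa [add_sub_cancel_left, mul_comm] at h1

end IsIntegralSolution
end LipschitzCurves

/-! ### The wave operator on V × H is maximal monotone -/

section WaveOperator

variable {H : Type*} [NormedAddCommGroup H] [InnerProductSpace ℝ H] [CompleteSpace H]

namespace EnergySpace

theorem ofH_apply (A : CoerciveOperator H) (h : H) (φ : EnergySpace A) :
    ofH A h φ = inner ℝ h (toH A φ) := rfl

theorem opV_apply (A : CoerciveOperator H) (u φ : EnergySpace A) :
    opV A u φ = inner ℝ u φ := rfl

/-- `ofH` as a continuous linear map. -/
noncomputable def ofHL (A : CoerciveOperator H) : H →L[ℝ] StrongDual ℝ (EnergySpace A) :=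
  LinearMap.mkContinuous
    { toFun := ofH A
      map_add' := fun x y => by
        ext φ
        simp only [ofH_apply, add_apply, inner_add_left]
      map_smul' := fun c x => by
        ext φ
        simp [ofH_apply, inner_smul_left] } ‖toH A‖ fun h => by
    refine ContinuousLinearMap.opNorm_le_bound _ (by positivity) fun φ => ?_
    refine (norm_inner_le_norm _ _).trans ?_
    rw [mul_right_comm, mul_comm]
    gcongr
    exact (toH A).le_opNorm φ

/-- `opV` as a continuous linear map. -/
noncomputable def opVL (A : CoerciveOperator H) :
    EnergySpace A →L[ℝ] StrongDual ℝ (EnergySpace A) :=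
  LinearMap.mkContinuous
    { toFun := opV A
      map_add' := fun x y => by
        ext φ
        simp only [opV_apply, add_apply, inner_add_left]
      map_smul' := fun c x => by
        ext φ
        simp [opV_apply, inner_smul_left] } 1 fun u => by
    refine ContinuousLinearMap.opNorm_le_bound _ (by positivity) fun φ => ?_
    rw [one_mul]
    exact norm_inner_le_norm _ _

theorem ofHL_apply (A : CoerciveOperator H) (h : H) : ofHL A h = ofH A h := rfl

theorem opVL_apply (A : CoerciveOperator H) (u : EnergySpace A) : opVL A u = opV A u := rfl

/-- Injectivity of H → V' is the density of D(A^{1/2}) in H. -/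
theorem eq_zero_of_ofH_eq_zero (A : CoerciveOperator H) {h : H} (hh : ofH A h = 0) : h = 0 :=
  A.sqrt_spec.isSelfAdjoint.dense_domain.eq_zero_of_inner_left (𝕜 := ℝ) fun φ hφ => by
    have h1 : ofH A h (⟨φ, hφ⟩ : A.sqrt.domain) = 0 := by rw [hh]; rfl
    exact h1

end EnergySpace

/-- The phase space `V × H` with its Hilbert norm. -/
abbrev PhaseSpace (A : CoerciveOperator H) : Type _ := WithLp 2 (EnergySpace A × H)

/-- The graph of `L (u, v) = (-v, A u + B v)` on `V × H`. -/
def waveGraph (A : CoerciveOperator H)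
    (B : EnergySpace A →L[ℝ] StrongDual ℝ (EnergySpace A)) :
    Submodule ℝ (PhaseSpace A × PhaseSpace A) where
  -- The witness v lifts the H-component of p to V. The last equation contains the requirement Au +
  -- Bv ∈ H.
  carrier := {p | ∃ v, toH A v = p.1.snd ∧ p.2.fst = -v ∧
    opVL A p.1.fst + B v = ofHL A p.2.snd}
  add_mem' := by
    rintro p q ⟨v, h1, h2, h3⟩ ⟨w, h4, h5, h6⟩
    refine ⟨v + w, ?_, ?_, ?_⟩
    · rw [map_add, h1, h4]; rfl
    · rw [Prod.snd_add, WithLp.add_fst, h2, h5, neg_add]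
    · rw [Prod.fst_add, Prod.snd_add, WithLp.add_fst, WithLp.add_snd, map_add, map_add, map_add,
        ← h3, ← h6]
      abel
  zero_mem' := ⟨0, by simp, by simp, by simp⟩
  smul_mem' := by
    rintro c p ⟨v, h1, h2, h3⟩
    refine ⟨c • v, ?_, ?_, ?_⟩
    · rw [map_smul, h1]; rfl
    · rw [Prod.smul_snd, WithLp.smul_fst, h2, smul_neg]
    · rw [Prod.smul_fst, Prod.smul_snd, WithLp.smul_fst, WithLp.smul_snd, map_smul, map_smul,
        map_smul, ← h3, smul_add]

variable {A : CoerciveOperator H} {B : EnergySpace A →L[ℝ] StrongDual ℝ (EnergySpace A)}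

theorem mem_waveGraph {p q : PhaseSpace A} : (p, q) ∈ waveGraph A B ↔
    ∃ v, toH A v = p.snd ∧ q.fst = -v ∧ opVL A p.fst + B v = ofHL A q.snd := Iff.rfl

/-- Monotonicity: testing Au + Bv with v produces ⟨u, v⟩_V, which the first component cancels,
leaving ⟨Bv, v⟩. Single-valuedness is injectivity of V → H and of H → V'. -/
theorem isMaximalMonotoneGraph_waveGraph (hB : ∀ v, 0 ≤ B v v) :
    IsMaximalMonotoneGraph (waveGraph A B) where
  nonneg := by
    rintro ⟨p, q⟩ ⟨v, h1, h2, h3⟩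
    have h4 : opVL A p.fst v + B v v = inner ℝ q.snd (toH A v) := by
      rw [← ofH_apply, ← ofHL_apply, ← h3, add_apply]
    simp only at h1 h2 h3
    rw [opVL_apply, opV_apply, h1] at h4
    change 0 ≤ inner ℝ p q
    rw [WithLp.prod_inner_apply]
    change 0 ≤ inner ℝ p.fst q.fst + inner ℝ p.snd q.snd
    rw [h2, inner_neg_right, real_inner_comm q.snd, ← h4]
    linarith [hB v]
  exists_add_smul := by
    intro c hc z
    -- Eliminating u = z₁ + cv from p + cLp = z leaves (I + c²A + cB)v = z₂ - cAz₁ in V'. The form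
    -- on the left is coercive with constant c², because both I and B contribute nonnegatively.
    let a : EnergySpace A →L[ℝ] EnergySpace A →L[ℝ] ℝ :=
      (ofHL A).comp (toH A) + c ^ 2 • opVL A + c • B
    have ha : ∀ v φ, a v φ = inner ℝ (toH A v) (toH A φ) + c ^ 2 * inner ℝ v φ + c * B v φ :=
      fun v φ => rfl
    have hco : IsCoercive a := by
      refine ⟨c ^ 2, by positivity, fun v => ?_⟩
      rw [ha, real_inner_self_eq_norm_sq, real_inner_self_eq_norm_sq]
      have := mul_nonneg hc.le (hB v)
      nlinarith [sq_nonneg ‖toH A v‖]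
    let ℓ : StrongDual ℝ (EnergySpace A) := ofHL A z.snd - c • opVL A z.fst
    set v := hco.continuousLinearEquivOfBilin.symm
      ((InnerProductSpace.toDual ℝ (EnergySpace A)).symm ℓ) with hv
    have hav : a v = ℓ := by
      ext φ
      rw [← hco.continuousLinearEquivOfBilin_apply, hv,
        ContinuousLinearEquiv.apply_symm_apply, InnerProductSpace.toDual_symm_apply]
    have hav' : ofHL A (toH A v) + c ^ 2 • opVL A v + c • B v
        = ofHL A z.snd - c • opVL A z.fst := hav
    refine ⟨(WithLp.toLp 2 (z.fst + c • v, toH A v),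
      WithLp.toLp 2 (-v, c⁻¹ • (z.snd - toH A v))), ⟨v, rfl, rfl, ?_⟩, ?_⟩
    · change opVL A (z.fst + c • v) + B v = ofHL A (c⁻¹ • (z.snd - toH A v))
      rw [map_smul, map_sub, map_add, map_smul]
      have h1 : ofHL A z.snd - ofHL A (toH A v) =
          c • (opVL A z.fst + c • opVL A v + B v) := by
        rw [sub_eq_iff_eq_add, ← sub_add_cancel (ofHL A z.snd) (c • opVL A z.fst), ← hav']
        module
      rw [h1, smul_smul, inv_mul_cancel₀ hc.ne', one_smul]
    · change WithLp.toLp 2 (z.fst + c • v, toH A v) +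
        c • WithLp.toLp 2 (-v, c⁻¹ • (z.snd - toH A v)) = z
      refine WithLp.ofLp_injective 2 (Prod.ext ?_ ?_)
      · change z.fst + c • v + c • (-v) = z.fst
        rw [smul_neg, add_neg_cancel_right]
      · change toH A v + c • (c⁻¹ • (z.snd - toH A v)) = z.snd
        rw [smul_smul, mul_inv_cancel₀ hc.ne', one_smul, add_sub_cancel]
  eq_zero := by
    rintro q ⟨v, h1, h2, h3⟩
    have hv : v = 0 := toH_injective A (by rw [h1, map_zero]; rfl)
    subst hv
    refine WithLp.ofLp_injective 2 (Prod.ext ?_ ?_)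
    · change q.fst = 0
      simpa using h2
    · change q.snd = 0
      refine eq_zero_of_ofH_eq_zero A ?_
      rw [← ofHL_apply, ← h3]
      simp

theorem mem_waveGraph_of_mem_domL {u₀ u₁ : EnergySpace A} (h : (u₀, u₁) ∈ domL A B) :
    ∃ y, (WithLp.toLp 2 (u₀, toH A u₁), y) ∈ waveGraph A B := by
  obtain ⟨h, hh⟩ := h
  exact ⟨WithLp.toLp 2 (-u₁, h), u₁, rfl, rfl, hh⟩

theorem integral_fst {U : ℝ → PhaseSpace A} {a b : ℝ} (hU : IntervalIntegrable U volume a b) :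
    (∫ s in a..b, U s).fst = ∫ s in a..b, (U s).fst :=
  ((WithLp.fstL 2 ℝ (EnergySpace A) H).intervalIntegral_comp_comm hU).symm

theorem integral_snd {U : ℝ → PhaseSpace A} {a b : ℝ} (hU : IntervalIntegrable U volume a b) :
    (∫ s in a..b, U s).snd = ∫ s in a..b, (U s).snd :=
  ((WithLp.sndL 2 ℝ (EnergySpace A) H).intervalIntegral_comp_comm hU).symm

theorem ContinuousLinearMap.intervalIntegrable_comp {E F : Type*} [NormedAddCommGroup E]
    [NormedSpace ℝ E] [NormedAddCommGroup F] [NormedSpace ℝ F] (L : E →L[ℝ] F) {g : ℝ → E}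
    {a b : ℝ} (hg : IntervalIntegrable g volume a b) :
    IntervalIntegrable (fun s => L (g s)) volume a b :=
  ⟨L.integrable_comp hg.1, L.integrable_comp hg.2⟩

/-- The forcing term `(0, h)` in the phase space. -/
noncomputable def forcing (A : CoerciveOperator H) : H →L[ℝ] PhaseSpace A :=
  ((WithLp.prodContinuousLinearEquiv 2 ℝ (EnergySpace A) H).symm :
    (EnergySpace A × H) →L[ℝ] PhaseSpace A).comp (ContinuousLinearMap.inr ℝ (EnergySpace A) H)

theorem forcing_fst (h : H) : (forcing A h).fst = 0 := rfl

theorem forcing_snd (h : H) : (forcing A h).snd = h := rfl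

theorem norm_forcing (h : H) : ‖forcing A h‖ = ‖h‖ := WithLp.norm_toLp_snd 2 _ _ h

/-- The time-integrated evolution equation in components. -/
theorem integral_mem_waveGraph_iff {t : ℝ} {U : ℝ → PhaseSpace A} {g : ℝ → H}
    (hU : IntervalIntegrable U volume 0 t) (hg : IntervalIntegrable g volume 0 t)
    (u₀ : EnergySpace A) (u₁ : H) :
    (∫ s in (0 : ℝ)..t, U s, WithLp.toLp 2 (u₀, u₁) - U t
        + ∫ s in (0 : ℝ)..t, forcing A (g s)) ∈ waveGraph A B ↔
      toH A (U t).fst = toH A u₀ + ∫ s in (0 : ℝ)..t, (U s).snd ∧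
      ofH A (U t).snd + B (U t).fst = ofH A u₁ + B u₀ +
        ∫ s in (0 : ℝ)..t, (ofH A (g s) - opV A (U s).fst) := by
  have hfg := ContinuousLinearMap.intervalIntegrable_comp (forcing A) hg
  have hgL := ContinuousLinearMap.intervalIntegrable_comp
    (F := StrongDual ℝ (EnergySpace A)) (ofHL A) hg
  have hu := ContinuousLinearMap.intervalIntegrable_comp (WithLp.fstL 2 ℝ (EnergySpace A) H) hU
  have huL := ContinuousLinearMap.intervalIntegrable_comp
    (F := StrongDual ℝ (EnergySpace A)) (opVL A) hu
  have e1 : ∫ s in (0 : ℝ)..t, (ofH A (g s) - opV A (U s).fst) =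
      ofHL A (∫ s in (0 : ℝ)..t, g s) - opVL A (∫ s in (0 : ℝ)..t, (U s).fst) := by
    rw [← ContinuousLinearMap.intervalIntegral_comp_comm (𝕜 := ℝ)
      (F := StrongDual ℝ (EnergySpace A)) (ofHL A) hg]
    have := ContinuousLinearMap.intervalIntegral_comp_comm (𝕜 := ℝ)
      (F := StrongDual ℝ (EnergySpace A)) (opVL A) hu
    simp only [WithLp.fstL_apply] at this huL
    rw [← this]
    exact intervalIntegral.integral_sub hgL huL
  rw [mem_waveGraph, integral_fst hU, integral_snd hU, e1]
  simp only [WithLp.add_fst, WithLp.add_snd, WithLp.sub_fst, WithLp.sub_snd, integral_fst hfg,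
    integral_snd hfg, forcing_fst, forcing_snd, WithLp.toLp_fst, WithLp.toLp_snd,
    intervalIntegral.integral_zero, add_zero, ← ofHL_apply]
  constructor
  · rintro ⟨v, h1, h2, h3⟩
    -- The first component of the graph relation identifies the lift to V of the time integral of
    -- the velocity as u(t) - u₀. So B acts on u(t) - u₀, which explains the term (u_t + Bu)_t in
    -- the weak formulation.
    have hv : v = (U t).fst - u₀ := by rw [← neg_sub, h2, neg_neg]
    subst hv
    refine ⟨?_, ?_⟩
    · rw [← h1, map_sub, add_sub_cancel]
    · rw [map_add, map_sub, map_sub] at h3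
      have h4 : opVL A (∫ s in (0 : ℝ)..t, (U s).fst) =
        ofHL A u₁ - ofHL A (U t).snd + ofHL A (∫ s in (0 : ℝ)..t, g s)
          - (B (U t).fst - B u₀) := eq_sub_of_add_eq h3
      rw [h4]
      abel
  · rintro ⟨h1, h2⟩
    refine ⟨(U t).fst - u₀, ?_, (neg_sub _ _).symm, ?_⟩
    · rw [map_sub, h1, add_sub_cancel_left]
    · rw [map_add, map_sub, map_sub]
      have h4 : ofHL A (U t).snd = ofHL A u₁ + B u₀ + (ofHL A (∫ s in (0 : ℝ)..t, g s)
          - opVL A (∫ s in (0 : ℝ)..t, (U s).fst)) - B (U t).fst := eq_sub_of_add_eq h2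
      rw [h4]
      abel

end WaveOperator

/-! ### Weak solutions as integrated solutions, and uniqueness -/

section Solutions

variable {H : Type*} [NormedAddCommGroup H] [InnerProductSpace ℝ H] [CompleteSpace H]
variable {A : CoerciveOperator H} {B : EnergySpace A →L[ℝ] StrongDual ℝ (EnergySpace A)}
variable {f : EnergySpace A → H}

theorem Continuous.memLp_Ioo {E : Type*} [NormedAddCommGroup E] {g : ℝ → E} (hg : Continuous g)
    (p : ENNReal) (S : ℝ) : MemLp g p (volume.restrict (Set.Ioo 0 S)) := by
  obtain ⟨C, hC⟩ := isCompact_Icc.exists_bound_of_continuousOn (s := Set.Icc (0 : ℝ) S)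
    hg.continuousOn
  refine MemLp.of_bound hg.aestronglyMeasurable C ?_
  filter_upwards [ae_restrict_mem measurableSet_Ioo] with t ht
  exact hC t ⟨ht.1.le, ht.2.le⟩

theorem restrict_Ioc_eq_Ioo (a b : ℝ) :
    (volume : Measure ℝ).restrict (Set.Ioc a b) = volume.restrict (Set.Ioo a b) :=
  (restrict_Ioo_eq_restrict_Ioc).symm

theorem MeasureTheory.MemLp.intervalIntegrable_of_Ioo {E : Type*} [NormedAddCommGroup E]
    {g : ℝ → E} {p : ENNReal} {S t : ℝ} (hg : MemLp g p (volume.restrict (Set.Ioo 0 S)))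
    (hp : 1 ≤ p) (ht : t ∈ Set.Icc 0 S) : IntervalIntegrable g volume 0 t := by
  rw [intervalIntegrable_iff_integrableOn_Ioc_of_le ht.1, IntegrableOn, restrict_Ioc_eq_Ioo]
  exact (hg.integrable hp).mono_measure
    (Measure.restrict_mono (Set.Ioo_subset_Ioo_right ht.2) le_rfl)

theorem continuous_of_lipschitz_on_balls
    (hf : ∀ K : ℝ, 0 < K → ∃ L : ℝ, ∀ u v : EnergySpace A, ‖u‖ ≤ K → ‖v‖ ≤ K →
      ‖f u - f v‖ ≤ L * ‖u - v‖) : Continuous f := by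
  refine continuous_iff_continuousAt.mpr fun u => ?_
  obtain ⟨L, hL⟩ := hf (‖u‖ + 1) (by positivity)
  have h1 : LipschitzOnWith L.toNNReal f (Metric.closedBall 0 (‖u‖ + 1)) := by
    refine LipschitzOnWith.of_dist_le_mul fun v hv w hw => ?_
    rw [mem_closedBall_zero_iff] at hv hw
    rw [dist_eq_norm, dist_eq_norm]
    exact (hL v w hv hw).trans
      (mul_le_mul_of_nonneg_right (Real.le_coe_toNNReal _) (norm_nonneg _))
  refine h1.continuousOn.continuousAt ?_
  refine Metric.closedBall_mem_nhds_of_mem ?_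
  rw [mem_ball_zero_iff]
  exact lt_add_one _

theorem continuous_fst_of_phase {U : ℝ → PhaseSpace A} (hU : Continuous U) :
    Continuous fun t => (U t).fst :=
  (WithLp.fstL 2 ℝ (EnergySpace A) H).continuous.comp hU

theorem continuous_snd_of_phase {U : ℝ → PhaseSpace A} (hU : Continuous U) :
    Continuous fun t => (U t).snd :=
  (WithLp.sndL 2 ℝ (EnergySpace A) H).continuous.comp hU

theorem IsIntegralSolution.initial_eq {X : Type*} [NormedAddCommGroup X]
    [InnerProductSpace ℝ X] {M : Submodule ℝ (X × X)} (hM : IsMaximalMonotoneGraph M)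
    {T : ℝ} (hT : 0 ≤ T) {x : X} {G U : ℝ → X} (hU : IsIntegralSolution M T x G U) :
    U 0 = x := by
  have h1 := hU.mem 0 ⟨le_rfl, hT⟩
  rw [intervalIntegral.integral_same, intervalIntegral.integral_same, add_zero] at h1
  exact (sub_eq_zero.mp (hM.eq_zero _ h1)).symm

theorem isContinuousWeakSolution_of_isIntegralSolution (hfc : Continuous f)
    {u₀ : EnergySpace A} {u₁ : H} {T : EReal} {U : ℝ → PhaseSpace A} (hUc : Continuous U)
    (hU0 : U 0 = WithLp.toLp 2 (u₀, u₁))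
    (hU : ∀ S : ℝ, 0 < S → (S : EReal) < T → IsIntegralSolution (waveGraph A B) S
      (WithLp.toLp 2 (u₀, u₁)) (fun t => forcing A (f (U t).fst)) U) :
    IsContinuousWeakSolution A B f u₀ u₁ T (fun t => (U t).fst) (fun t => (U t).snd) := by
  have huc := continuous_fst_of_phase hUc
  have hvc := continuous_snd_of_phase hUc
  have hfuc : Continuous fun t => f (U t).fst := hfc.comp huc
  have hcomp : ∀ S : ℝ, 0 < S → (S : EReal) < T → ∀ t ∈ Set.Icc 0 S,
      toH A (U t).fst = toH A u₀ + ∫ s in (0 : ℝ)..t, (U s).snd ∧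
      ofH A (U t).snd + B (U t).fst = ofH A u₁ + B u₀ +
        ∫ s in (0 : ℝ)..t, (ofH A (f (U s).fst) - opV A (U s).fst) := fun S hS hST t ht =>
    (integral_mem_waveGraph_iff (hUc.intervalIntegrable _ _) (hfuc.intervalIntegrable _ _)
      u₀ u₁).mp ((hU S hS hST).mem t ht)
  refine ⟨⟨fun S _ _ => huc.memLp_Ioo 2 S, fun S _ _ => hfuc.memLp_Ioo 2 S,
    fun S hS hST => ⟨?_, hvc.memLp_Ioo 2 S, ?_⟩, fun S hS hST => ⟨?_, ?_, ?_⟩⟩,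
    (huc.prodMk hvc).continuousOn, by rw [hU0]; exact ⟨rfl, rfl⟩⟩
  · exact ((toH A).continuous.comp huc).memLp_Ioo 2 S
  · filter_upwards [ae_restrict_mem measurableSet_Ioo] with t ht
    exact (hcomp S hS hST t ⟨ht.1.le, ht.2.le⟩).1
  · exact (((ofHL A).continuous.comp hvc).add (B.continuous.comp huc)).memLp_Ioo 2 S
  · exact (((ofHL A).continuous.comp hfuc).sub ((opVL A).continuous.comp huc)).memLp_Ioo 2 S
  · filter_upwards [ae_restrict_mem measurableSet_Ioo] with t ht
    exact (hcomp S hS hST t ⟨ht.1.le, ht.2.le⟩).2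

theorem MeasureTheory.MemLp.toLp_prod {g : ℝ → EnergySpace A} {h : ℝ → H} {μ : Measure ℝ}
    {p : ENNReal} (hg : MemLp g p μ) (hh : MemLp h p μ) :
    MemLp (fun t => (WithLp.toLp 2 (g t, h t) : PhaseSpace A)) p μ := by
  have h1 := (((WithLp.prodContinuousLinearEquiv 2 ℝ (EnergySpace A) H).symm :
    (EnergySpace A × H) →L[ℝ] PhaseSpace A).comp
      (ContinuousLinearMap.inl ℝ (EnergySpace A) H)).comp_memLp' hg
  refine (h1.add ((forcing A).comp_memLp' hh)).ae_eq (Filter.Eventually.of_forall fun t => ?_)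
  refine WithLp.ofLp_injective 2 (Prod.ext ?_ ?_)
  · exact add_zero (g t)
  · exact zero_add (h t)

/-- With f(u) regarded as a given source, the weak formulation is the integrated linear equation
a.e., so (u, v) has a continuous representative solving it everywhere. Replacing u by that
representative inside f changes the source on a null set only. -/
theorem IsWeakSolution.exists_isIntegralSolution (hB : ∀ v, 0 ≤ B v v)
    {u₀ : EnergySpace A} {u₁ : H} {T : EReal} {u : ℝ → EnergySpace A} {v : ℝ → H}
    (h : IsWeakSolution A B f u₀ u₁ T u v) {S : ℝ} (hS : 0 < S) (hST : (S : EReal) < T) :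
    ∃ V : ℝ → PhaseSpace A, IsIntegralSolution (waveGraph A B) S (WithLp.toLp 2 (u₀, u₁))
        (fun t => forcing A (f (V t).fst)) V ∧
      ∀ᵐ t ∂(volume.restrict (Set.Ioo 0 S)), u t = (V t).fst ∧ v t = (V t).snd := by
  have hu := h.memLp S hS hST
  have hfu := h.memLp_source S hS hST
  obtain ⟨-, hv, hder⟩ := h.deriv_eq S hS hST
  obtain ⟨-, -, heq⟩ := h.equation S hS hST
  have hU := hu.toLp_prod hv
  have hSS : S ∈ Set.Icc 0 S := ⟨hS.le, le_rfl⟩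
  have hfi := fun t (ht : t ∈ Set.Icc 0 S) => hfu.intervalIntegrable_of_Ioo one_le_two ht
  have hUi := fun t (ht : t ∈ Set.Icc 0 S) => hU.intervalIntegrable_of_Ioo one_le_two ht
  obtain ⟨V, hV, hVU⟩ := (isMaximalMonotoneGraph_waveGraph hB).exists_integralSolution_ae_eq
    hS.le (x := WithLp.toLp 2 (u₀, u₁))
    (ContinuousLinearMap.intervalIntegrable_comp (forcing A) (hfi S hSS)) (hUi S hSS) (by
      rw [restrict_Ioc_eq_Ioo]
      filter_upwards [hder, heq, ae_restrict_mem measurableSet_Ioo] with t h1 h2 ht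
      have ht' : t ∈ Set.Icc 0 S := ⟨ht.1.le, ht.2.le⟩
      exact (integral_mem_waveGraph_iff (hUi t ht') (hfi t ht') u₀ u₁).mpr ⟨h1, h2⟩)
  have hVU' : ∀ᵐ t ∂(volume.restrict (Set.Ioc 0 S)),
      u t = (V t).fst ∧ v t = (V t).snd := by
    filter_upwards [hVU] with t ht
    rw [← ht]
    exact ⟨rfl, rfl⟩
  refine ⟨V, hV.congr_source ?_, by rwa [restrict_Ioc_eq_Ioo] at hVU'⟩
  filter_upwards [hVU'] with t ht
  rw [ht.1]

/-- Both curves are continuous, hence bounded on [0, S]. On a ball containing both, f is Lipschitz,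
and Grönwall applies with initial difference zero. -/
theorem isIntegralSolution_eq_of_lipschitz_on_balls (hB : ∀ v, 0 ≤ B v v)
    (hf : ∀ K : ℝ, 0 < K → ∃ L : ℝ, ∀ u v : EnergySpace A, ‖u‖ ≤ K → ‖v‖ ≤ K →
      ‖f u - f v‖ ≤ L * ‖u - v‖) {x : PhaseSpace A} {S : ℝ} {U V : ℝ → PhaseSpace A}
    (hU : IsIntegralSolution (waveGraph A B) S x (fun t => forcing A (f (U t).fst)) U)
    (hV : IsIntegralSolution (waveGraph A B) S x (fun t => forcing A (f (V t).fst)) V)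
    {t : ℝ} (ht : t ∈ Set.Icc 0 S) : V t = U t := by
  have hfc := continuous_of_lipschitz_on_balls hf
  have hsrc : ∀ {W : ℝ → PhaseSpace A}, Continuous W →
      Continuous fun t => forcing A (f (W t).fst) := fun hW =>
    (forcing A).continuous.comp (hfc.comp (continuous_fst_of_phase hW))
  have hGU := hsrc hU.continuous
  have hGV := hsrc hV.continuous
  obtain ⟨C, hC⟩ := isCompact_Icc.exists_bound_of_continuousOn (s := Set.Icc (0 : ℝ) S)
    hU.continuous.continuousOn
  obtain ⟨D, hD⟩ := isCompact_Icc.exists_bound_of_continuousOn (s := Set.Icc (0 : ℝ) S)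
    hV.continuous.continuousOn
  -- The 1 only makes the radius positive; |L| is used below because L carries no sign.
  obtain ⟨L, hL⟩ := hf (max (max C D) 1) (by positivity)
  have hfst : ∀ p : PhaseSpace A, ‖p.fst‖ ≤ ‖p‖ := fun p => WithLp.norm_fst_le _ p
  have hgr : ∀ t ∈ Set.Icc 0 S, ‖V t - U t‖ ≤
      0 + |L| * ∫ s in (0 : ℝ)..t, ‖V s - U s‖ := by
    intro t ht
    have h1 := (isMaximalMonotoneGraph_waveGraph hB).norm_integralSolution_sub_le
      (hGV.intervalIntegrable 0 S) (hGU.intervalIntegrable 0 S) hV hU ht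
    rw [sub_self, norm_zero] at h1
    refine h1.trans (add_le_add le_rfl ?_)
    rw [← intervalIntegral.integral_const_mul]
    refine intervalIntegral.integral_mono_on ht.1 ((hGV.sub hGU).norm.intervalIntegrable _ _)
      ((continuous_const.mul (hV.continuous.sub hU.continuous).norm).intervalIntegrable _ _)
      fun s hs => ?_
    have hs' : s ∈ Set.Icc 0 S := ⟨hs.1, hs.2.trans ht.2⟩
    rw [← map_sub, norm_forcing]
    refine (hL _ _ ?_ ?_).trans ?_
    · exact (hfst _).trans ((hD s hs').trans ((le_max_right _ _).trans (le_max_left _ _)))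
    · exact (hfst _).trans ((hC s hs').trans ((le_max_left _ _).trans (le_max_left _ _)))
    · refine mul_le_mul (le_abs_self L) ?_ (norm_nonneg _) (abs_nonneg L)
      exact hfst (V s - U s)
  have h2 := le_mul_exp_of_le_add_integral (hV.continuous.sub hU.continuous).norm
    (abs_nonneg L) hgr ht
  rw [zero_mul] at h2
  exact sub_eq_zero.mp (norm_le_zero_iff.mp h2)

theorem ae_restrict_Ioi_of_forall {P : ℝ → Prop}
    (h : ∀ S : ℝ, 0 < S → ∀ᵐ t ∂(volume.restrict (Set.Ioo 0 S)), P t) :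
    ∀ᵐ t ∂(volume.restrict (Set.Ioi (0 : ℝ))), P t := by
  have hU : Set.Ioi (0 : ℝ) = ⋃ n : ℕ, Set.Ioo 0 ((n : ℝ) + 1) := by
    ext t
    simp only [Set.mem_Ioi, Set.mem_iUnion, Set.mem_Ioo]
    refine ⟨fun ht => ?_, fun ⟨n, hn⟩ => hn.1⟩
    obtain ⟨n, hn⟩ := exists_nat_gt t
    exact ⟨n, ht, hn.trans (lt_add_one _)⟩
  rw [hU, ae_restrict_iUnion_iff]
  exact fun n => h _ (by positivity)

theorem IsWeakSolution.ae_eq (hB : ∀ v, 0 ≤ B v v)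
    (hf : ∀ K : ℝ, 0 < K → ∃ L : ℝ, ∀ u v : EnergySpace A, ‖u‖ ≤ K → ‖v‖ ≤ K →
      ‖f u - f v‖ ≤ L * ‖u - v‖) {u₀ : EnergySpace A} {u₁ : H} {U : ℝ → PhaseSpace A}
    (hU : ∀ S : ℝ, 0 ≤ S → IsIntegralSolution (waveGraph A B) S
      (WithLp.toLp 2 (u₀, u₁)) (fun t => forcing A (f (U t).fst)) U)
    {u : ℝ → EnergySpace A} {v : ℝ → H} (h : IsWeakSolution A B f u₀ u₁ ⊤ u v) :
    ∀ᵐ t ∂(volume.restrict (Set.Ioi 0)), u t = (U t).fst ∧ v t = (U t).snd := by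
  refine ae_restrict_Ioi_of_forall fun S hS => ?_
  obtain ⟨V, hV, hVu⟩ := h.exists_isIntegralSolution hB hS (EReal.coe_lt_top S)
  filter_upwards [hVu, ae_restrict_mem measurableSet_Ioo] with t ht htS
  rwa [← isIntegralSolution_eq_of_lipschitz_on_balls hB hf (hU S hS.le) hV
    ⟨htS.1.le, htS.2.le⟩]

end Solutions

/-! ### The radial retraction onto a ball -/

section RadialRetraction

variable {E : Type*} [NormedAddCommGroup E] [NormedSpace ℝ E]

/-- The radial retraction onto the closed ball of radius `K`. -/
noncomputable def radialRetraction (K : ℝ) (u : E) : E := (K / max K ‖u‖) • u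

theorem norm_radialRetraction_le {K : ℝ} (hK : 0 < K) (u : E) : ‖radialRetraction K u‖ ≤ K := by
  have h0 : 0 < max K ‖u‖ := lt_max_of_lt_left hK
  rw [radialRetraction, norm_smul, Real.norm_of_nonneg (by positivity), div_mul_eq_mul_div,
    div_le_iff₀ h0]
  exact mul_le_mul_of_nonneg_left (le_max_right _ _) hK.le

theorem radialRetraction_eq_self {K : ℝ} (hK : 0 < K) {u : E} (hu : ‖u‖ ≤ K) :
    radialRetraction K u = u := by
  rw [radialRetraction, max_eq_left hu, div_self hK.ne', one_smul]

/-- With a = max(K, ‖u‖) and b = max(K, ‖v‖), the difference splits as (K/a)(u - v) + (K/a - K/b)v,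
and each summand is at most ‖u - v‖. The constant 2 is not sharp in a Hilbert space, but any
constant suffices. -/
theorem norm_radialRetraction_sub_le {K : ℝ} (hK : 0 < K) (u v : E) :
    ‖radialRetraction K u - radialRetraction K v‖ ≤ 2 * ‖u - v‖ := by
  set a := max K ‖u‖ with ha
  set b := max K ‖v‖ with hb
  have ha0 : 0 < a := lt_max_of_lt_left hK
  have hb0 : 0 < b := lt_max_of_lt_left hK
  have h1 : radialRetraction K u - radialRetraction K v
      = (K / a) • (u - v) + (K / a - K / b) • v := by
    rw [radialRetraction, radialRetraction]
    module
  have h2 : ‖(K / a) • (u - v)‖ ≤ ‖u - v‖ := by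
    rw [norm_smul, Real.norm_of_nonneg (by positivity)]
    exact mul_le_of_le_one_left (norm_nonneg _) ((div_le_one ha0).mpr (le_max_left _ _))
  have h3 : ‖(K / a - K / b) • v‖ ≤ ‖u - v‖ := by
    have e1 : K / a - K / b = (K / a) * ((b - a) / b) := by field_simp
    have e2 : |b - a| ≤ ‖u - v‖ := by
      rw [abs_sub_comm, ha, hb, max_comm K, max_comm K]
      exact (abs_max_sub_max_le_abs _ _ _).trans (abs_norm_sub_norm_le u v)
    rw [norm_smul, Real.norm_eq_abs, e1, abs_mul, abs_div (b - a), abs_of_pos hb0,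
      abs_of_pos (by positivity : 0 < K / a)]
    calc K / a * (|b - a| / b) * ‖v‖ = (K / a) * (‖v‖ / b) * |b - a| := by ring
      _ ≤ 1 * 1 * |b - a| := by
        gcongr
        · exact (div_le_one ha0).mpr (le_max_left _ _)
        · exact (div_le_one hb0).mpr (le_max_right _ _)
      _ ≤ ‖u - v‖ := by rw [one_mul, one_mul]; exact e2
  rw [h1, two_mul]
  exact (norm_add_le _ _).trans (add_le_add h2 h3)

end RadialRetraction

/-! ### Truncation, global existence and strong solutions -/

section GlobalSolutions

variable {H : Type*} [NormedAddCommGroup H] [InnerProductSpace ℝ H] [CompleteSpace H]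
variable {A : CoerciveOperator H} {B : EnergySpace A →L[ℝ] StrongDual ℝ (EnergySpace A)}
variable {f : EnergySpace A → H}

/-- Composing f with the retraction only ever evaluates it in the ball of radius K, where it is
Lipschitz, and changes nothing inside that ball. -/
theorem exists_lipschitz_truncation
    (hf : ∀ K : ℝ, 0 < K → ∃ L : ℝ, ∀ u v : EnergySpace A, ‖u‖ ≤ K → ‖v‖ ≤ K →
      ‖f u - f v‖ ≤ L * ‖u - v‖) {K : ℝ} (hK : 0 < K) :
    ∃ (ω : NNReal) (Φ : PhaseSpace A → PhaseSpace A), LipschitzWith ω Φ ∧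
      ∀ p : PhaseSpace A, ‖p.fst‖ ≤ K → Φ p = forcing A (f p.fst) := by
  obtain ⟨L, hL⟩ := hf K hK
  refine ⟨(|L| * 2).toNNReal, fun p => forcing A (f (radialRetraction K p.fst)),
    LipschitzWith.of_dist_le_mul fun p q => ?_, fun p hp => ?_⟩
  · rw [dist_eq_norm, ← map_sub, norm_forcing, dist_eq_norm, Real.coe_toNNReal _ (by positivity)]
    refine (hL _ _ (norm_radialRetraction_le hK _) (norm_radialRetraction_le hK _)).trans ?_
    rw [mul_assoc]
    refine mul_le_mul (le_abs_self L) ((norm_radialRetraction_sub_le hK _ _).trans ?_)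
      (norm_nonneg _) (abs_nonneg L)
    refine mul_le_mul_of_nonneg_left ?_ zero_le_two
    exact WithLp.norm_fst_le _ (p - q)
  · simp only [radialRetraction_eq_self hK hp]

open Filter Topology in
/-- An a priori bound of the `V`-norm on every existence interval yields a global solution. -/
theorem exists_global_of_apriori_bound (hB : ∀ v, 0 ≤ B v v)
    (hf : ∀ K : ℝ, 0 < K → ∃ L : ℝ, ∀ u v : EnergySpace A, ‖u‖ ≤ K → ‖v‖ ≤ K →
      ‖f u - f v‖ ≤ L * ‖u - v‖) (x : PhaseSpace A) (R : ℝ)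
    (hR : ∀ (T : EReal) (U : ℝ → PhaseSpace A), 0 < T → Continuous U → U 0 = x →
      (∀ y, (x, y) ∈ waveGraph A B →
        ∀ S : ℝ, ∃ C : NNReal, LipschitzOnWith C U (Set.Icc 0 S)) →
      (∀ S : ℝ, 0 < S → (S : EReal) < T →
        IsIntegralSolution (waveGraph A B) S x (fun t => forcing A (f (U t).fst)) U) →
      ∀ t : ℝ, 0 < t → (t : EReal) < T → ‖(U t).fst‖ ≤ R) :
    ∃ U : ℝ → PhaseSpace A, Continuous U ∧ U 0 = x ∧
      (∀ y, (x, y) ∈ waveGraph A B →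
        ∀ S : ℝ, ∃ C : NNReal, LipschitzOnWith C U (Set.Icc 0 S)) ∧
      ∀ S : ℝ, 0 ≤ S →
        IsIntegralSolution (waveGraph A B) S x (fun t => forcing A (f (U t).fst)) U := by
  have hM := isMaximalMonotoneGraph_waveGraph hB
  -- K exceeds R and the initial norm strictly, which leaves the gap needed for the contradiction at
  -- the first exit time.
  set K : ℝ := max R ‖x.fst‖ + 1 with hK
  have hRK : R < K := by rw [hK]; linarith [le_max_left R ‖x.fst‖]
  have hxK : ‖x.fst‖ < K := by rw [hK]; linarith [le_max_right R ‖x.fst‖]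
  have hK0 : 0 < K := (norm_nonneg _).trans_lt hxK
  obtain ⟨ω, Φ, hΦ, hΦf⟩ := exists_lipschitz_truncation hf hK0
  obtain ⟨U, hU⟩ := hM.exists_semilinear hΦ x
  have hUc : Continuous U := (hU 0 le_rfl).continuous
  have huc : Continuous fun t => ‖(U t).fst‖ := (continuous_fst_of_phase hUc).norm
  have hU0 : U 0 = x := (hU 0 le_rfl).initial_eq hM le_rfl
  -- Regularity comes from the truncated equation, whose nonlinearity is globally Lipschitz. It is
  -- therefore available before the bound is known, as the a priori hypothesis for strong solutions
  -- requires.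
  have hLip : ∀ y, (x, y) ∈ waveGraph A B →
      ∀ S : ℝ, ∃ C : NNReal, LipschitzOnWith C U (Set.Icc 0 S) := fun y hy S =>
    hM.exists_lipschitzOnWith_of_mem hΦ hy hU S
  have hsol : ∀ S : ℝ, 0 ≤ S → (∀ t ∈ Set.Icc 0 S, ‖(U t).fst‖ ≤ K) →
      IsIntegralSolution (waveGraph A B) S x (fun t => forcing A (f (U t).fst)) U := by
    intro S hS h
    refine (hU S hS).congr_source ?_
    filter_upwards [ae_restrict_mem measurableSet_Ioc] with t ht
    exact hΦf _ (h t ⟨ht.1.le, ht.2⟩)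
  have hbound : ∀ t, 0 ≤ t → ‖(U t).fst‖ < K := by
    by_contra! hcon
    -- Let τ be the first time with ‖u‖_V ≥ K. On [0, τ) the truncation is inactive, so the a priori
    -- bound applies with T = τ; by continuity ‖u(τ)‖_V ≤ R < K, a contradiction.
    set Z : Set ℝ := {t | 0 ≤ t ∧ K ≤ ‖(U t).fst‖} with hZ
    have hZne : Z.Nonempty := hcon
    have hZb : BddBelow Z := ⟨0, fun t ht => ht.1⟩
    have hZc : IsClosed Z := (isClosed_le continuous_const continuous_id).inter
      (isClosed_le continuous_const huc)
    set τ := sInf Z with hτ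
    have hτZ : τ ∈ Z := hZc.csInf_mem hZne hZb
    have hτ0 : 0 < τ := by
      refine lt_of_le_of_ne hτZ.1 fun h0 => ?_
      have := hτZ.2
      rw [← h0, hU0] at this
      exact absurd this (not_le.mpr hxK)
    have hlt : ∀ t, 0 ≤ t → t < τ → ‖(U t).fst‖ < K := by
      intro t ht htτ
      by_contra! h
      exact absurd (csInf_le hZb ⟨ht, h⟩) (not_le.mpr htτ)
    have h1 := hR τ U (by exact_mod_cast hτ0) hUc hU0 hLip fun S hS hSτ =>
      hsol S hS.le fun t ht => (hlt t ht.1 (ht.2.trans_lt (by exact_mod_cast hSτ))).le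
    have h2 : ‖(U τ).fst‖ ≤ R := by
      refine le_of_tendsto (huc.tendsto τ |>.mono_left (nhdsWithin_le_nhds (s := Set.Iio τ))) ?_
      filter_upwards [Ioo_mem_nhdsLT hτ0] with t ht
      exact h1 t ht.1 (by exact_mod_cast ht.2)
    exact absurd (hτZ.2.trans h2) (not_le.mpr hRK)
  exact ⟨U, hUc, hU0, hLip, fun S hS => hsol S hS fun t ht => (hbound t ht.1).le⟩

/-- The velocity is lifted from H to V at every time by `exists_mem_of_lipschitzOnWith`. The
equation holds a.e. by `mem_of_hasDerivAt`, since U is a.e. differentiable with bounded derivative.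
-/
theorem exists_isContinuousStrongSolution_of_isIntegralSolution (hB : ∀ v, 0 ≤ B v v)
    (hfc : Continuous f) {u₀ u₁ : EnergySpace A} {T : EReal} (hT : 0 < T) {U : ℝ → PhaseSpace A}
    (hUc : Continuous U) (hU0 : U 0 = WithLp.toLp 2 (u₀, toH A u₁))
    (hLip : ∀ S : ℝ, ∃ C : NNReal, LipschitzOnWith C U (Set.Icc 0 S))
    (hU : ∀ S : ℝ, 0 < S → (S : EReal) < T → IsIntegralSolution (waveGraph A B) S
      (WithLp.toLp 2 (u₀, toH A u₁)) (fun t => forcing A (f (U t).fst)) U) :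
    ∃ v : ℝ → EnergySpace A, (∀ t ∈ timeInterval T, toH A (v t) = (U t).snd) ∧
      IsContinuousStrongSolution A B f u₀ u₁ T (fun t => (U t).fst) v := by
  have hM := isMaximalMonotoneGraph_waveGraph hB
  have huc := continuous_fst_of_phase hUc
  have hvc := continuous_snd_of_phase hUc
  have hGc : Continuous fun t => forcing A (f (U t).fst) :=
    (forcing A).continuous.comp (hfc.comp huc)
  have hex : ∀ t, ∃ w, t ∈ timeInterval T → toH A w = (U t).snd := by
    intro t
    by_cases ht : t ∈ timeInterval T
    · obtain ⟨S, htS, hST⟩ := EReal.lt_iff_exists_real_btwn.mp ht.2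
      have htS' : t < S := by exact_mod_cast htS
      obtain ⟨C, hC⟩ := hLip S
      obtain ⟨y, w, hw, -⟩ := (hU S (ht.1.trans_lt htS') hST).exists_mem_of_lipschitzOnWith hM
        hGc hC ht.1 htS'
      exact ⟨w, fun _ => hw⟩
    · exact ⟨0, fun h => absurd h ht⟩
  choose v hv using hex
  have h0T : (0 : ℝ) ∈ timeInterval T := ⟨le_rfl, by exact_mod_cast hT⟩
  -- The lift is available at t = 0 too, and injectivity of V → H makes it the prescribed u₁.
  have hv0 : v 0 = u₁ := toH_injective A (by rw [hv 0 h0T, hU0]; rfl)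
  refine ⟨v, hv, ⟨fun t => (deriv U t).snd, fun S hS hST => ?_⟩, ?_, ⟨by rw [hU0]; rfl, hv0⟩⟩
  · obtain ⟨C, hC⟩ := hLip S
    obtain ⟨hdL, hd, hint⟩ := hC.ae_hasDerivAt_and_eq_integral hS.le
    have hdI : ∀ t ∈ Set.Icc 0 S, IntervalIntegrable (deriv U) volume 0 t := fun t ht =>
      hdL.intervalIntegrable_of_Ioo le_top ht
    have hdom : ∀ t ∈ Set.Ioo 0 S, t ∈ timeInterval T := fun t ht =>
      ⟨ht.1.le, lt_trans (by exact_mod_cast ht.2) hST⟩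
    have hkey : ∀ᵐ t ∂(volume.restrict (Set.Ioo 0 S)), (deriv U t).fst = v t ∧
        opV A (U t).fst + B (v t) = ofH A (f (U t).fst - (deriv U t).snd) := by
      filter_upwards [hd, ae_restrict_mem measurableSet_Ioo] with t ht htS
      obtain ⟨w, h1, h2, h3⟩ := (hU S hS hST).mem_of_hasDerivAt hM hGc htS ht
      have hw : w = v t := toH_injective A (by rw [h1, hv t (hdom t htS)])
      subst hw
      refine ⟨?_, h3⟩
      rw [WithLp.sub_fst, forcing_fst, zero_sub] at h2
      exact neg_injective h2
    have hdfst : MemLp (fun t => (deriv U t).fst) ⊤ (volume.restrict (Set.Ioo 0 S)) :=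
      (WithLp.fstL 2 ℝ (EnergySpace A) H).comp_memLp' hdL
    have hdsnd : MemLp (fun t => (deriv U t).snd) ⊤ (volume.restrict (Set.Ioo 0 S)) :=
      (WithLp.sndL 2 ℝ (EnergySpace A) H).comp_memLp' hdL
    have hveq : ∀ t ∈ Set.Ioo 0 S, (U t).snd = toH A (v t) := fun t ht =>
      (hv t (hdom t ht)).symm
    refine ⟨⟨huc.memLp_Ioo ⊤ S, hdfst.ae_eq ?_, ?_⟩, ⟨(hvc.memLp_Ioo ⊤ S).ae_eq ?_, hdsnd, ?_⟩,
      ?_⟩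
    · filter_upwards [hkey] with t ht using ht.1
    · filter_upwards [ae_restrict_mem measurableSet_Ioo] with t ht
      have ht' : t ∈ Set.Icc 0 S := ⟨ht.1.le, ht.2.le⟩
      rw [hint t ht', WithLp.add_fst, integral_fst (hdI t ht'), hU0]
      congr 1
      rw [intervalIntegral.integral_of_le ht.1.le, intervalIntegral.integral_of_le ht.1.le,
        restrict_Ioc_eq_Ioo]
      refine integral_congr_ae ?_
      filter_upwards [ae_restrict_of_ae_restrict_of_subset
        (Set.Ioo_subset_Ioo_right ht.2.le) hkey] with s hs using hs.1
    · filter_upwards [ae_restrict_mem measurableSet_Ioo] with t ht using hveq t ht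
    · filter_upwards [ae_restrict_mem measurableSet_Ioo] with t ht
      have ht' : t ∈ Set.Icc 0 S := ⟨ht.1.le, ht.2.le⟩
      rw [← hveq t ht, hint t ht', WithLp.add_snd, integral_snd (hdI t ht'), hU0, WithLp.toLp_snd]
    · filter_upwards [hkey] with t ht
      refine ⟨⟨_, ht.2⟩, ?_⟩
      rw [ht.2, ← ofHL_apply, ← ofHL_apply, ← ofHL_apply, ← map_add, add_sub_cancel]
  · refine (huc.prodMk hvc).continuousOn.congr fun t ht => ?_
    rw [hv t ht]

/-- A continuous representative of u gives measurability and boundedness of f(u). The derivative is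
cut off outside (0, S] to be integrable on the whole line. -/
theorem HasSobolevDeriv.exists_continuous_ae_eq {X : Type*} [NormedAddCommGroup X]
    [NormedSpace ℝ X] {p : ENNReal} (hp : 1 ≤ p) {S : ℝ} {x₀ : X} {w g : ℝ → X}
    (h : HasSobolevDeriv p S x₀ w g) :
    ∃ w' : ℝ → X, Continuous w' ∧ ∀ᵐ t ∂(volume.restrict (Set.Ioo 0 S)), w t = w' t := by
  obtain ⟨-, hg, hw⟩ := h
  have hgi : Integrable ((Set.Ioc 0 S).indicator g) := by
    rw [integrable_indicator_iff measurableSet_Ioc, IntegrableOn, restrict_Ioc_eq_Ioo]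
    exact hg.integrable hp
  refine ⟨fun t => x₀ + ∫ s in (0 : ℝ)..t, (Set.Ioc 0 S).indicator g s,
    continuous_const.add
      (intervalIntegral.continuous_primitive (fun a b => hgi.intervalIntegrable) 0), ?_⟩
  filter_upwards [hw, ae_restrict_mem measurableSet_Ioo] with t ht htS
  rw [ht, intervalIntegral.integral_of_le htS.1.le, intervalIntegral.integral_of_le htS.1.le]
  congr 1
  exact setIntegral_congr_fun measurableSet_Ioc fun s hs =>
    (Set.indicator_of_mem (s := Set.Ioc 0 S) ⟨hs.1, hs.2.trans htS.2.le⟩ g).symm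

theorem integral_ofH_add {a : ℝ → H} {v : ℝ → EnergySpace A} {t : ℝ}
    (ha : IntervalIntegrable a volume 0 t) (hv : IntervalIntegrable v volume 0 t) :
    ∫ s in (0 : ℝ)..t, (ofH A (a s) + B (v s)) =
      ofH A (∫ s in (0 : ℝ)..t, a s) + B (∫ s in (0 : ℝ)..t, v s) := by
  have e1 := ContinuousLinearMap.intervalIntegral_comp_comm (𝕜 := ℝ)
    (F := StrongDual ℝ (EnergySpace A)) (ofHL A) ha
  have e2 := ContinuousLinearMap.intervalIntegral_comp_comm (𝕜 := ℝ)
    (F := StrongDual ℝ (EnergySpace A)) B hv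
  rw [← ofHL_apply, ← e1, ← e2]
  exact intervalIntegral.integral_add
    (ContinuousLinearMap.intervalIntegrable_comp
      (F := StrongDual ℝ (EnergySpace A)) (ofHL A) ha)
    (ContinuousLinearMap.intervalIntegrable_comp
      (F := StrongDual ℝ (EnergySpace A)) B hv)

/-- Integrating the pointwise equation in V' turns Bu_t into B(u - u₀). Uniqueness of strong
solutions thereby reduces to uniqueness of weak ones. -/
theorem IsStrongSolution.isWeakSolution
    (hf : ∀ K : ℝ, 0 < K → ∃ L : ℝ, ∀ u v : EnergySpace A, ‖u‖ ≤ K → ‖v‖ ≤ K →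
      ‖f u - f v‖ ≤ L * ‖u - v‖) {u₀ u₁ : EnergySpace A} {T : EReal}
    {u v : ℝ → EnergySpace A} (h : IsStrongSolution A B f u₀ u₁ T u v) :
    IsWeakSolution A B f u₀ (toH A u₁) T u (fun t => toH A (v t)) := by
  obtain ⟨a, ha⟩ := h
  have hfc := continuous_of_lipschitz_on_balls hf
  refine ⟨fun S hS hST => (ha S hS hST).1.1.mono_exponent le_top,
    fun S hS hST => ?_, fun S hS hST => ?_, fun S hS hST => ?_⟩ <;>
  obtain ⟨⟨hu, hv, huv⟩, ⟨hvH, haL, hva⟩, heq⟩ := ha S hS hST <;>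
  obtain ⟨u', hu'c, hu'⟩ := HasSobolevDeriv.exists_continuous_ae_eq le_top ⟨hu, hv, huv⟩
  · refine ((hfc.comp hu'c).memLp_Ioo 2 S).ae_eq ?_
    filter_upwards [hu'] with t ht
    rw [ht]
    rfl
  · refine ⟨((toH A).comp_memLp' hu).mono_exponent le_top, hvH.mono_exponent le_top, ?_⟩
    filter_upwards [huv, ae_restrict_mem measurableSet_Ioo] with t ht htS
    rw [ht, map_add, ← (toH A).intervalIntegral_comp_comm
      (hv.intervalIntegrable_of_Ioo le_top ⟨htS.1.le, htS.2.le⟩)]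
  · obtain ⟨v', hv'c, hv'⟩ := HasSobolevDeriv.exists_continuous_ae_eq le_top ⟨hvH, haL, hva⟩
    refine ⟨(Continuous.memLp_Ioo (((ofHL A).continuous.comp hv'c).add
      (B.continuous.comp hu'c)) 2 S).ae_eq ?_, (Continuous.memLp_Ioo
        (((ofHL A).continuous.comp (hfc.comp hu'c)).sub ((opVL A).continuous.comp hu'c))
        2 S).ae_eq ?_, ?_⟩
    · filter_upwards [hu', hv'] with t h1 h2
      rw [h1, h2]
      rfl
    · filter_upwards [hu'] with t h1
      rw [h1]
      rfl
    filter_upwards [huv, hva, ae_restrict_mem measurableSet_Ioo] with t htu htv htS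
    have ht' : t ∈ Set.Icc 0 S := ⟨htS.1.le, htS.2.le⟩
    have e1 : ∫ s in (0 : ℝ)..t, (ofH A (f (u s)) - opV A (u s)) =
        ∫ s in (0 : ℝ)..t, (ofH A (a s) + B (v s)) := by
      rw [intervalIntegral.integral_of_le htS.1.le, intervalIntegral.integral_of_le htS.1.le,
        restrict_Ioc_eq_Ioo]
      refine integral_congr_ae ?_
      filter_upwards [ae_restrict_of_ae_restrict_of_subset
        (Set.Ioo_subset_Ioo_right htS.2.le) heq] with s hs
      rw [← hs.2]
      abel
    rw [e1, integral_ofH_add (haL.intervalIntegrable_of_Ioo le_top ht')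
      (hv.intervalIntegrable_of_Ioo le_top ht'), htu, htv, ← ofHL_apply, ← ofHL_apply,
      ← ofHL_apply, map_add, map_add]
    abel

/-- Because 𝓕 ≤ 0, the energy dominates ½‖u‖_V². -/
theorem norm_le_of_energy_le {F : EnergySpace A → ℝ} (hF : ∀ u, F u ≤ 0) {u : EnergySpace A}
    {v : H} {e : ℝ} (h : energy A F u v ≤ e) : ‖u‖ ≤ √(2 * e) := by
  refine Real.le_sqrt_of_sq_le ?_
  have h1 := hF u
  rw [energy] at h
  nlinarith [sq_nonneg ‖v‖]

end GlobalSolutions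

theorem theorem2p3 {H : Type*} [NormedAddCommGroup H] [InnerProductSpace ℝ H] [CompleteSpace H]
    (A : CoerciveOperator H)
    (B : EnergySpace A →L[ℝ] StrongDual ℝ (EnergySpace A)) (hB : ∀ v, 0 ≤ B v v)
    (f : EnergySpace A → H)
    (hf : ∀ K : ℝ, 0 < K → ∃ L : ℝ, ∀ u v : EnergySpace A, ‖u‖ ≤ K → ‖v‖ ≤ K →
      ‖f u - f v‖ ≤ L * ‖u - v‖)
    (F : EnergySpace A → ℝ) (hF_zero : F 0 = 0)
    (hF_deriv : ∀ u, HasFDerivAt F (ofH A (f u)) u)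
    (hF_nonpos : ∀ u, F u ≤ 0) :
    (∀ u₀ u₁ : EnergySpace A, (u₀, u₁) ∈ domL A B →
      (∃ C : ℝ, 0 < C ∧ ∀ (T : EReal) (u v : ℝ → EnergySpace A), 0 < T →
        IsContinuousStrongSolution A B f u₀ u₁ T u v →
        ∀ t : ℝ, 0 < t → (t : EReal) < T →
          energy A F (u t) (toH A (v t)) ≤ C * energy A F (u 0) (toH A (v 0))) →
      ∃ u v : ℝ → EnergySpace A, IsContinuousStrongSolution A B f u₀ u₁ ⊤ u v ∧
        ∀ u' v' : ℝ → EnergySpace A, IsStrongSolution A B f u₀ u₁ ⊤ u' v' →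
          ∀ᵐ t ∂(volume.restrict (Set.Ioi 0)), u' t = u t ∧ v' t = v t) ∧
    (∀ (u₀ : EnergySpace A) (u₁ : H),
      (∃ C : ℝ, 0 < C ∧ ∀ (T : EReal) (u : ℝ → EnergySpace A) (v : ℝ → H), 0 < T →
        IsContinuousWeakSolution A B f u₀ u₁ T u v →
        ∀ t : ℝ, 0 < t → (t : EReal) < T →
          energy A F (u t) (v t) ≤ C * energy A F (u 0) (v 0)) →
      ∃ (u : ℝ → EnergySpace A) (v : ℝ → H), IsContinuousWeakSolution A B f u₀ u₁ ⊤ u v ∧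
        ∀ (u' : ℝ → EnergySpace A) (v' : ℝ → H), IsWeakSolution A B f u₀ u₁ ⊤ u' v' →
          ∀ᵐ t ∂(volume.restrict (Set.Ioi 0)), u' t = u t ∧ v' t = v t) := by
  have hfc := continuous_of_lipschitz_on_balls hf
  refine ⟨fun u₀ u₁ hdom ⟨C, _, hC⟩ => ?_, fun u₀ u₁ ⟨C, _, hC⟩ => ?_⟩
  · obtain ⟨y, hy⟩ := mem_waveGraph_of_mem_domL hdom
    -- The radius comes from ½‖u‖_V² ≤ E(t) ≤ C·E(0). As E(0) depends on the data only, one radius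
    -- serves every existence interval.
    obtain ⟨U, hUc, hU0, hLip, hU⟩ := exists_global_of_apriori_bound hB hf
      (WithLp.toLp 2 (u₀, toH A u₁)) (√(2 * (C * energy A F u₀ (toH A u₁)))) (by
        intro T U hT hUc hU0 hLip hU t ht htT
        obtain ⟨v, hv, hsol⟩ := exists_isContinuousStrongSolution_of_isIntegralSolution hB hfc hT
          hUc hU0 (hLip y hy) hU
        have h := hC T _ v hT hsol t ht htT
        rw [hsol.initial.1, hsol.initial.2] at h
        exact norm_le_of_energy_le hF_nonpos h)
    obtain ⟨v, hv, hsol⟩ := exists_isContinuousStrongSolution_of_isIntegralSolution hB hfc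
      EReal.zero_lt_top hUc hU0 (hLip y hy) fun S hS _ => hU S hS.le
    refine ⟨_, v, hsol, fun u' v' h' => ?_⟩
    filter_upwards [(h'.isWeakSolution hf).ae_eq hB hf hU, ae_restrict_mem measurableSet_Ioi]
      with t ht ht0
    -- Weak uniqueness compares velocities in H; injectivity of V → H lifts the equality to V.
    refine ⟨ht.1, toH_injective A ?_⟩
    rw [ht.2, hv t ⟨le_of_lt ht0, EReal.coe_lt_top t⟩]
  · obtain ⟨U, hUc, hU0, -, hU⟩ := exists_global_of_apriori_bound hB hf
      (WithLp.toLp 2 (u₀, u₁)) (√(2 * (C * energy A F u₀ u₁))) (by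
        intro T U hT hUc hU0 _ hU t ht htT
        have hsol := isContinuousWeakSolution_of_isIntegralSolution hfc hUc hU0 hU
        have h := hC T _ _ hT hsol t ht htT
        rw [hsol.initial.1, hsol.initial.2] at h
        exact norm_le_of_energy_le hF_nonpos h)
    exact ⟨_, _, isContinuousWeakSolution_of_isIntegralSolution hfc hUc hU0
      fun S hS _ => hU S hS.le, fun u' v' h' => h'.ae_eq hB hf hU⟩
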